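/- Notation. An abstract Swiss cheese is a sequence $B=((b_n,s_n))_{n\ge 0}$ with $b_n\in\mathbb{C}$ and $s_n\in[0,\infty)$. Write $D(a,r)$ and $\overline D(a,r)$ for the open and closed disks of centre $a$ and radius $r$, with $D(a,0)=\emptyset$ and $\overline D(a,0)=\{a\}$. Put $X_B=\overline D(b_0,s_0)\setminus\bigcup_{n\ge1}D(b_n,s_n)$. The cheese $B$ is classical if $\sum_{n\ge1}s_n<\infty$, $s_0>0$, and for all $k\ge1$ with $s_k>0$ we have $\overline D(b_k,s_k)\subseteq D(b_0,s_0)$ and $\overline D(b_k,s_k)\cap\overline D(b_l,s_l)=\emptyset$ for every $l\ge1$ with $l\ne k$ and $s_l>0$. For a compact set $X\subseteq\mathbb{C}$, $R(X)$ is the closure, in $C(X)$ with the uniform norm, of the algebra of rational functions with poles off $X$. A bounded point derivation on $R(X)$ is a continuous linear functional $d$ on $R(X)$ for which there is a character $\varphi$ of $R(X)$ with $d(fg)=\varphi(f)d(g)+d(f)\varphi(g)$ for all $f,g\in R(X)$. A commutative Banach algebra $A$ is weakly amenable if every continuous derivation from $A$ into a commutative Banach $A$-bimodule is zero. Theorem.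 For each $C>0$ there exists a classical abstract Swiss cheese $B=((b_n,s_n))$ such that $s_0=1$, the unit circle $\mathbb{T}$ is contained in $X_B$, $R(X_B)$ has no non-zero bounded point derivations, and $$\sum_{n=1}^\infty \frac{s_n}{d_n^2}\le C,$$ where $d_n$ is the distance from the disk $D(b_n,s_n)$ to $\mathbb{T}$ if $s_n>0$, and $d_n=1$ if $s_n=0$. Moreover, $B$ can be chosen so that, in addition, $R(X_B)$ is not weakly amenable. -/

import Mathlib

open scoped NNReal

namespace SwissCheese

/-! ### Abstract Swiss cheeses -/

/-- An abstract Swiss cheese `((a_n, r_n))`: a sequence, indexed by `n = 0, 1, 2, …`, of pairs of a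
centre `a_n ∈ ℂ` and a radius `r_n ≥ 0`. The pair with index `0` stands for the closed disk, the
others for the open disks that are deleted from it. -/
abbrev AbstractSwissCheese : Type := ℕ → ℂ × ℝ≥0

/-- The centre `a_n`. -/
def center (A : AbstractSwissCheese) (n : ℕ) : ℂ := (A n).1

/-- The radius `r_n`, as a real number. -/
def radius (A : AbstractSwissCheese) (n : ℕ) : ℝ := ((A n).2 : ℝ)

/-- The open disk of centre `a_n` and radius `r_n`; it is empty if `r_n = 0`. -/
def openDisk (A : AbstractSwissCheese) (n : ℕ) : Set ℂ := Metric.ball (center A n) (radius A n)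

/-- The closed disk of centre `a_n` and radius `r_n`; it is `{a_n}` if `r_n = 0`. -/
def closedDisk (A : AbstractSwissCheese) (n : ℕ) : Set ℂ :=
  Metric.closedBall (center A n) (radius A n)

/-- The significant index set `S_A = {n ≥ 1 : r_n > 0}`. -/
def significant (A : AbstractSwissCheese) : Set ℕ := {n | 1 ≤ n ∧ 0 < radius A n}

/-- The set underlying the Swiss cheese set: the closed disk with index `0` minus the union of the
open disks with indices `n ≥ 1`. -/
def cheeseCarrier (A : AbstractSwissCheese) : Set ℂ :=
  closedDisk A 0 \ ⋃ n : ℕ, openDisk A (n + 1)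

theorem isCompact_cheeseCarrier (A : AbstractSwissCheese) : IsCompact (cheeseCarrier A) :=
  (isCompact_closedBall _ _).diff (isOpen_iUnion fun _ => Metric.isOpen_ball)

/-- The associated Swiss cheese set `X_A`, as a compact subset of the plane. -/
def cheeseSet (A : AbstractSwissCheese) : TopologicalSpace.Compacts ℂ :=
  ⟨cheeseCarrier A, isCompact_cheeseCarrier A⟩

/-- `A` is classical: the radii `r_1, r_2, …` are summable, `r_0 > 0`, and the closed disks with
significant index lie in the open disk with index `0` and are pairwise disjoint. -/
structure IsClassical (A : AbstractSwissCheese) : Prop where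
  summable_radius : Summable fun n : ℕ => radius A (n + 1)
  radius_zero_pos : 0 < radius A 0
  closedDisk_subset : ∀ k ∈ significant A, closedDisk A k ⊆ openDisk A 0
  disjoint : ∀ k ∈ significant A, ∀ l ∈ significant A, l ≠ k →
    Disjoint (closedDisk A k) (closedDisk A l)

/-- The distance `inf {|z - w| : z ∈ S, w ∈ T}` between two (non-empty) plane sets. -/
noncomputable def setDist (S T : Set ℂ) : ℝ := sInf (Set.image2 dist S T)

/-- The number `d_n`: the distance from the open disk with index `n` to the unit circle if
`r_n > 0`, and `1` if `r_n = 0`. -/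
noncomputable def circleDist (A : AbstractSwissCheese) (n : ℕ) : ℝ :=
  open Classical in
  if 0 < radius A n then setDist (openDisk A n) (Metric.sphere (0 : ℂ) 1) else 1

/-! ### The uniform algebra `R(X)` -/

/-- `R₀(X)`: the algebra of (restrictions to `X` of) rational functions with poles off `X`. -/
def ratAlgZero (X : TopologicalSpace.Compacts ℂ) : Subalgebra ℂ C(X, ℂ) where
  carrier := {f | ∃ p q : Polynomial ℂ, ∀ z : X, q.eval (z : ℂ) ≠ 0 ∧
    f z = p.eval (z : ℂ) / q.eval (z : ℂ)}
  mul_mem' := by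
    rintro f g ⟨p, q, h⟩ ⟨p', q', h'⟩
    refine ⟨p * p', q * q', fun z => ⟨?_, ?_⟩⟩
    · simpa using ⟨(h z).1, (h' z).1⟩
    · simp [(h z).2, (h' z).2, div_mul_div_comm]
  add_mem' := by
    rintro f g ⟨p, q, h⟩ ⟨p', q', h'⟩
    refine ⟨p * q' + q * p', q * q', fun z => ⟨?_, ?_⟩⟩
    · simpa using ⟨(h z).1, (h' z).1⟩
    · simp [(h z).2, (h' z).2, div_add_div _ _ (h z).1 (h' z).1]
  algebraMap_mem' c := ⟨Polynomial.C c, 1, fun z => by simp⟩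

/-- `R(X)`: the closure of `R₀(X)` in `C(X)` for the uniform norm. -/
noncomputable def ratAlg (X : TopologicalSpace.Compacts ℂ) : Subalgebra ℂ C(X, ℂ) :=
  (ratAlgZero X).topologicalClosure

/-! ### Derivations -/

/-- There are no non-zero bounded point derivations on `A`: for every character `φ` on `A`, the
only continuous linear functional `d` with `d(ab) = φ(a)d(b) + d(a)φ(b)` is zero. -/
def HasNoBoundedPointDerivations (A : Type*) [NormedCommRing A] [NormedAlgebra ℂ A] : Prop :=
  ∀ (φ : A →ₐ[ℂ] ℂ) (d : A →L[ℂ] ℂ), (∀ a b : A, d (a * b) = φ a * d b + d a * φ b) → d = 0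

/-- `A` is weakly amenable: every continuous derivation from `A` into a commutative Banach
`A`-bimodule is zero. A commutative Banach `A`-bimodule is a Banach space `E` with a bounded
bilinear action `act` of `A` satisfying `(ab)·x = a·(b·x)`, the right action being equal to the left
one. (The universe of `E` is that of `A`, which is where the dual module of `A` lives.) -/
def IsWeaklyAmenable.{u} (A : Type u) [NormedCommRing A] [NormedAlgebra ℂ A] : Prop :=
  ∀ (E : Type u) [NormedAddCommGroup E] [NormedSpace ℂ E] [CompleteSpace E]
    (act : A →L[ℂ] E →L[ℂ] E), (∀ (a b : A) (x : E), act (a * b) x = act a (act b x)) →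
    ∀ D : A →L[ℂ] E, (∀ a b : A, D (a * b) = act a (D b) + act b (D a)) → D = 0

end SwissCheese

/-!
The holes are added in finite stages. At a given stage, choose `ρ > 0` small compared with the old
holes, and remove tiny disks of equal radius `r` around the points of a square lattice of mesh
`1 / N`, as far as they keep a distance of order `ρ` from the unit circle and do not meet the old
holes. The density `ε = N² r` is fixed first, small enough for the new holes to add little to
`∑ sₙ / dₙ²`. A point `a` of the cheese within `ρ` of an old hole or of the unit circle has a pole
off the cheese at a distance about `ρ`, and `ρ / (z - b)` is bounded by `1` and has derivative of
size `1 / ρ` at `a`. Any other point is surrounded by complete boxes of lattice disks, and the sum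
of the terms `r / (z - b)` over these, with phases aligned at `a`, is bounded on the cheese, as
`∑ r / |z - b|` is at most a constant plus a multiple of `ε`, while its derivative at `a` is at
least of the order of `ε log (ρ N)`. So a large `N` forces derivatives as large as desired at all
points (`IsAdmissible.exists_superset`). In the limit no point admits a bounded point derivation,
because a point derivation at `a` is a multiple of `f ↦ f'(a)` on rational functions
(`hasNoBoundedPointDerivations_of_hasLargeDerivatives`).

That `R(X)` is not weakly amenable only needs `∑ sₙ / dₙ² < ∞` and the presence of one hole. The
form `(f, g) ↦ ∮ f'(z) g(z) dz` over the unit circle satisfies the derivation identity. It is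
bounded for the uniform norm on `X`: a rational function splits as `f = f₀ + ∑ hₖ`, with `f₀`
analytic on the closed disk and `hₖ` analytic off the `k`-th hole and vanishing at infinity
(`hasHoleDecomposition_rational`), and Cauchy's formula on the boundary of the hole, which lies in
`X`, bounds `hₖ'` on the unit circle by `‖f‖ sₖ / dₖ²`
(`HasHoleDecomposition.exists_circle_decomposition`). Cauchy's theorem annihilates `∮ f₀' g₀`, and
integration by parts bounds the remaining terms (`norm_circleForm_le_of_hasHoleDecomposition`). The
form extends to a continuous derivation from `R(X)` into its dual, and it is non-zero since
`∮ dz / (z - b) = 2πi` for the centre `b` of a hole.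
-/

namespace SwissCheese

/-! ### Sums of reciprocals over a square lattice -/

/-- The point `(i + j√-1) / N` of the square lattice with mesh `1 / N`. -/
noncomputable def latticePoint (N : ℕ) (p : ℤ × ℤ) : ℂ := ⟨p.1 / N, p.2 / N⟩

/-- The index of a lattice point nearest to `z`. -/
noncomputable def nearestIndex (N : ℕ) (z : ℂ) : ℤ × ℤ := (round (N * z.re), round (N * z.im))

/-- The supremum norm of an integer vector; `Finset.box n` is the set of vectors with norm `n`. -/
def boxNorm (p : ℤ × ℤ) : ℕ := max p.1.natAbs p.2.natAbs

theorem mem_box_iff {p : ℤ × ℤ} {n : ℕ} : p ∈ Finset.box n ↔ boxNorm p = n := Int.mem_box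

theorem natCast_boxNorm (p : ℤ × ℤ) : (boxNorm p : ℝ) = max |(p.1 : ℝ)| |(p.2 : ℝ)| := by
  simp [boxNorm, Nat.cast_natAbs]

theorem boxNorm_le_norm_sub {N : ℕ} (hN : 0 < N) (z : ℂ) (p : ℤ × ℤ) :
    (boxNorm (p - nearestIndex N z) : ℝ) / (2 * N) ≤ ‖z - latticePoint N p‖ := by
  have hN' : (0 : ℝ) < N := by exact_mod_cast hN
  -- A nonzero integer is at least `1`, so moving by the rounding error `1/2` at most halves it.
  have key : ∀ (x : ℝ) (i : ℤ), |((i - round (N * x) : ℤ) : ℝ)| / (2 * N) ≤ |x - i / N| := by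
    intro x i
    rcases eq_or_ne (i - round (N * x)) 0 with h | h
    · rw [h]; simp
    have h1 : (1 : ℝ) ≤ |((i - round (N * x) : ℤ) : ℝ)| := by
      exact_mod_cast Int.one_le_abs h
    have h2 := abs_sub_round ((N : ℝ) * x)
    have h3 : |((i - round (N * x) : ℤ) : ℝ)| ≤ |N * x - i| + |N * x - round (N * x)| := by
      push_cast
      rw [abs_sub_comm (N * x : ℝ) i]
      calc _ = |((i : ℝ) - N * x) + (N * x - round (N * x))| := by congr 1; ring
        _ ≤ _ := abs_add_le _ _
    have h4 : |x - i / N| = |N * x - i| / N := by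
      rw [← abs_of_pos hN', ← abs_div, abs_of_pos hN']; congr 1; field_simp
    rw [h4, div_le_div_iff₀ (by positivity) hN']
    nlinarith
  rw [natCast_boxNorm, ← max_div_div_right (by positivity)]
  refine max_le ((key z.re p.1).trans ?_) ((key z.im p.2).trans ?_)
  · simpa [latticePoint] using Complex.abs_re_le_norm (z - latticePoint N p)
  · simpa [latticePoint] using Complex.abs_im_le_norm (z - latticePoint N p)

theorem norm_sub_le_boxNorm {N : ℕ} (hN : 0 < N) (z : ℂ) (p : ℤ × ℤ)
    (hp : 1 ≤ boxNorm (p - nearestIndex N z)) :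
    ‖z - latticePoint N p‖ ≤ 3 * boxNorm (p - nearestIndex N z) / N := by
  have hN' : (0 : ℝ) < N := by exact_mod_cast hN
  have key : ∀ (x : ℝ) (i : ℤ), |x - i / N| ≤ (|((i - round (N * x) : ℤ) : ℝ)| + 1 / 2) / N := by
    intro x i
    have h2 := abs_sub_round ((N : ℝ) * x)
    have h3 : |N * x - i| ≤ |((i - round (N * x) : ℤ) : ℝ)| + |N * x - round (N * x)| := by
      push_cast
      rw [abs_sub_comm (i : ℝ)]
      calc _ = |((round (N * x) : ℝ) - i) + (N * x - round (N * x))| := by congr 1; ring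
        _ ≤ _ := abs_add_le _ _
    have h4 : |x - i / N| = |N * x - i| / N := by
      rw [← abs_of_pos hN', ← abs_div, abs_of_pos hN']; congr 1; field_simp
    rw [h4]
    gcongr
    linarith
  have h := Complex.norm_le_abs_re_add_abs_im (z - latticePoint N p)
  have h1 := key z.re p.1
  have h2 := key z.im p.2
  have hp' : (1 : ℝ) ≤ boxNorm (p - nearestIndex N z) := by exact_mod_cast hp
  have h3 : |((p.1 - round (N * z.re) : ℤ) : ℝ)| ≤ boxNorm (p - nearestIndex N z) := by
    rw [natCast_boxNorm]; exact le_max_left _ _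
  have h4 : |((p.2 - round (N * z.im) : ℤ) : ℝ)| ≤ boxNorm (p - nearestIndex N z) := by
    rw [natCast_boxNorm]; exact le_max_right _ _
  calc ‖z - latticePoint N p‖ ≤ |z.re - p.1 / N| + |z.im - p.2 / N| := by
        simpa [latticePoint] using h
    _ ≤ (boxNorm (p - nearestIndex N z) + 1 / 2) / N
        + (boxNorm (p - nearestIndex N z) + 1 / 2) / N := by
        refine add_le_add (h1.trans ?_) (h2.trans ?_) <;> gcongr
    _ ≤ 3 * boxNorm (p - nearestIndex N z) / N := by
        rw [← add_div]; gcongr; linarith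

theorem latticePoint_injective {N : ℕ} (hN : 0 < N) : Function.Injective (latticePoint N) := by
  have hN' : (N : ℝ) ≠ 0 := by exact_mod_cast hN.ne'
  intro p q h
  simp only [latticePoint, Complex.mk.injEq] at h
  ext
  · exact_mod_cast (div_left_inj' hN').1 h.1
  · exact_mod_cast (div_left_inj' hN').1 h.2

theorem inv_le_dist_latticePoint {N : ℕ} (hN : 0 < N) {p q : ℤ × ℤ} (h : p ≠ q) :
    1 / (N : ℝ) ≤ dist (latticePoint N p) (latticePoint N q) := by
  have hN' : (0 : ℝ) < N := by exact_mod_cast hN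
  have key : ∀ i j : ℤ, i ≠ j → 1 / (N : ℝ) ≤ |(i : ℝ) / N - j / N| := by
    intro i j hij
    have h1 : (1 : ℝ) ≤ |((i - j : ℤ) : ℝ)| := by
      exact_mod_cast Int.one_le_abs (sub_ne_zero.2 hij)
    rw [← sub_div, abs_div, abs_of_pos hN']
    push_cast at h1
    gcongr
  rw [dist_eq_norm]
  by_cases h1 : p.1 = q.1
  · have h2 : p.2 ≠ q.2 := fun h2 => h (Prod.ext h1 h2)
    refine (key _ _ h2).trans ?_
    simpa [latticePoint] using Complex.abs_im_le_norm (latticePoint N p - latticePoint N q)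
  · refine (key _ _ h1).trans ?_
    simpa [latticePoint] using Complex.abs_re_le_norm (latticePoint N p - latticePoint N q)

theorem mem_Icc_of_norm_latticePoint_le_one {N : ℕ} (hN : 0 < N) {p : ℤ × ℤ}
    (h : ‖latticePoint N p‖ ≤ 1) :
    p ∈ Finset.Icc (-(N : ℤ)) N ×ˢ Finset.Icc (-(N : ℤ)) N := by
  have hN' : (0 : ℝ) < N := by exact_mod_cast hN
  have key : ∀ i : ℤ, |(i : ℝ) / N| ≤ 1 → i ∈ Finset.Icc (-(N : ℤ)) N := by
    intro i hi
    rw [abs_div, abs_of_pos hN', div_le_one hN'] at hi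
    rw [Finset.mem_Icc, ← abs_le]
    exact_mod_cast hi
  rw [Finset.mem_product]
  exact ⟨key _ (((Complex.abs_re_le_norm _).trans h)), key _ (((Complex.abs_im_le_norm _).trans h))⟩

/-- The reciprocals of the distances from `z` to lattice points in the unit disk sum to `O(N²)`,
apart from the point nearest to `z`: the box of radius `m` contributes `8m` terms of size
`O(N / m)`. -/
theorem sum_div_norm_sub_latticePoint_le {N : ℕ} (hN : 0 < N) {z : ℂ} (hz : ‖z‖ ≤ 1) {r : ℝ}
    (hr : 0 ≤ r) (P : Finset (ℤ × ℤ)) (hP : ∀ p ∈ P, ‖latticePoint N p‖ ≤ 1)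
    (hzP : ∀ p ∈ P, r ≤ ‖z - latticePoint N p‖) :
    ∑ p ∈ P, r / ‖z - latticePoint N p‖ ≤ 1 + 64 * N ^ 2 * r := by
  have hN' : (0 : ℝ) < N := by exact_mod_cast hN
  set q := nearestIndex N z with hq
  have hmaps : ∀ p ∈ P, boxNorm (p - q) ∈ Finset.range (4 * N + 1) := by
    intro p hp
    have h1 := boxNorm_le_norm_sub hN z p
    have h2 : ‖z - latticePoint N p‖ ≤ 2 := by
      linarith [norm_sub_le z (latticePoint N p), hP p hp]
    rw [Finset.mem_range, Nat.lt_succ_iff]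
    have h3 := (div_le_iff₀ (by positivity)).1 (h1.trans h2)
    have h4 : (boxNorm (p - q) : ℝ) ≤ (4 * N : ℕ) := by push_cast; rw [hq]; linarith
    exact_mod_cast h4
  have hfib : ∀ m ∈ Finset.range (4 * N + 1),
      ∑ p ∈ P with boxNorm (p - q) = m, r / ‖z - latticePoint N p‖
        ≤ if m = 0 then 1 else 16 * N * r := by
    intro m _
    have hcard : (P.filter fun p => boxNorm (p - q) = m).card ≤
        (Finset.box m : Finset (ℤ × ℤ)).card := by
      refine Finset.card_le_card_of_injOn (fun p => p - q) ?_ ?_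
      · intro p hp
        have := (Finset.mem_filter.1 (Finset.mem_coe.1 hp)).2
        exact Finset.mem_coe.2 (mem_box_iff.2 this)
      · intro p _ p' _ h
        exact sub_left_injective h
    split_ifs with hm
    · subst hm
      rw [Finset.box_zero, Finset.card_singleton] at hcard
      calc _ ≤ ∑ p ∈ P with boxNorm (p - q) = 0, (1 : ℝ) := by
            refine Finset.sum_le_sum fun p hp => ?_
            exact div_le_one_of_le₀ (hzP p (Finset.mem_filter.1 hp).1) (norm_nonneg _)
        _ ≤ 1 := by
            rw [Finset.sum_const, nsmul_eq_mul, mul_one]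
            exact_mod_cast hcard
    · have hm' : (0 : ℝ) < m := by exact_mod_cast Nat.pos_of_ne_zero hm
      rw [Int.card_box hm] at hcard
      calc _ ≤ ∑ p ∈ P with boxNorm (p - q) = m, r / (m / (2 * N)) := by
            refine Finset.sum_le_sum fun p hp => ?_
            have h1 := boxNorm_le_norm_sub hN z p
            rw [← hq, (Finset.mem_filter.1 hp).2] at h1
            gcongr
        _ ≤ (8 * m : ℕ) * (r / (m / (2 * N))) := by
            rw [Finset.sum_const, nsmul_eq_mul]
            gcongr
        _ = 16 * N * r := by push_cast; field_simp; ring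
  rw [← Finset.sum_fiberwise_of_maps_to hmaps]
  refine (Finset.sum_le_sum hfib).trans (le_of_eq ?_)
  rw [Finset.sum_range_succ']
  simp
  ring

/-- The lattice points in the boxes of radii `1, …, K` around the point nearest to `a`. -/
noncomputable def nearbyIndices (N K : ℕ) (a : ℂ) : Finset (ℤ × ℤ) :=
  ((Finset.Icc 1 K).biUnion fun m => (Finset.box m : Finset (ℤ × ℤ))).map
    (addRightEmbedding (nearestIndex N a))

theorem norm_sub_le_of_mem_nearbyIndices {N K : ℕ} (hN : 0 < N) {a : ℂ} {p : ℤ × ℤ}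
    (hp : p ∈ nearbyIndices N K a) : ‖a - latticePoint N p‖ ≤ 3 * K / N := by
  simp only [nearbyIndices, Finset.mem_map, Finset.mem_biUnion, Finset.mem_Icc, mem_box_iff,
    addRightEmbedding_apply] at hp
  obtain ⟨x, ⟨m, ⟨hm1, hmK⟩, hx⟩, rfl⟩ := hp
  have h := norm_sub_le_boxNorm hN a (x + nearestIndex N a) (by simpa [hx] using hm1)
  refine h.trans ?_
  rw [add_sub_cancel_right, hx]
  gcongr

/-- The squared reciprocals of the distances from `a` to nearby lattice points have a
logarithmically divergent sum: the box of radius `m` contributes about `N² / m`. -/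
theorem le_sum_div_norm_sub_latticePoint_sq {N : ℕ} (hN : 0 < N) (K : ℕ) (a : ℂ) {r : ℝ}
    (hr : 0 < r) (ha : ∀ p ∈ nearbyIndices N K a, r ≤ ‖a - latticePoint N p‖) :
    8 / 9 * (N ^ 2 * r) * ∑ m ∈ Finset.Icc 1 K, 1 / (m : ℝ) ≤
      ∑ p ∈ nearbyIndices N K a, r / ‖a - latticePoint N p‖ ^ 2 := by
  have hN' : (0 : ℝ) < N := by exact_mod_cast hN
  have hdisj : Set.PairwiseDisjoint (Finset.Icc 1 K : Set ℕ)
      (fun m => (Finset.box m : Finset (ℤ × ℤ))) := by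
    intro m _ m' _ h
    rw [Function.onFun, Finset.disjoint_left]
    intro x hx hx'
    exact h ((mem_box_iff.1 hx).symm.trans (mem_box_iff.1 hx'))
  have hmem : ∀ m ∈ Finset.Icc 1 K, ∀ x ∈ (Finset.box m : Finset (ℤ × ℤ)),
      x + nearestIndex N a ∈ nearbyIndices N K a := by
    intro m hm x hx
    simp only [nearbyIndices, Finset.mem_map, Finset.mem_biUnion, addRightEmbedding_apply]
    exact ⟨x, ⟨m, hm, hx⟩, rfl⟩
  rw [nearbyIndices, Finset.sum_map, Finset.sum_biUnion hdisj, Finset.mul_sum]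
  refine Finset.sum_le_sum fun m hm => ?_
  have hm1 : 1 ≤ m := (Finset.mem_Icc.1 hm).1
  have hm' : (0 : ℝ) < m := by exact_mod_cast hm1
  calc 8 / 9 * (N ^ 2 * r) * (1 / (m : ℝ))
      = ((Finset.box m : Finset (ℤ × ℤ)).card : ℝ) * (r / (3 * m / N) ^ 2) := by
        rw [Int.card_box (by omega)]; push_cast; field_simp; ring
    _ = ∑ _x ∈ (Finset.box m : Finset (ℤ × ℤ)), r / (3 * m / N) ^ 2 := by
        rw [Finset.sum_const, nsmul_eq_mul]
    _ ≤ _ := by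
        refine Finset.sum_le_sum fun x hx => ?_
        have hx' := mem_box_iff.1 hx
        have h := norm_sub_le_boxNorm hN a (x + nearestIndex N a) (by simpa [hx'] using hm1)
        rw [add_sub_cancel_right, hx'] at h
        have h0 := hr.trans_le (ha _ (hmem m hm x hx))
        simp only [addRightEmbedding_apply]
        gcongr

/-! ### Adding holes that force large derivatives -/

/-- A finite family of holes, each given by its centre and radius, that may occur in a classical
Swiss cheese in the unit disk with `∑ sₙ / dₙ² < C`. -/
structure IsAdmissible (C : ℝ) (H : Finset (ℂ × ℝ≥0)) : Prop where
  pos : ∀ x ∈ H, 0 < x.2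
  lt_one : ∀ x ∈ H, ‖x.1‖ + x.2 < 1
  disjoint : ∀ x ∈ H, ∀ y ∈ H, x ≠ y →
    Disjoint (Metric.closedBall x.1 (x.2 : ℝ)) (Metric.closedBall y.1 (y.2 : ℝ))
  sum_lt : ∑ x ∈ H, (x.2 : ℝ) / (1 - ‖x.1‖ - x.2) ^ 2 < C

/-- The closed unit disk with the holes of a finite family removed. -/
def holeComplement (H : Finset (ℂ × ℝ≥0)) : Set ℂ :=
  {z | ‖z‖ ≤ 1 ∧ ∀ x ∈ H, (x.2 : ℝ) ≤ dist z x.1}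

/-- At every point of `Y` some linear combination of functions `1 / (z - b)` with poles `b` off `Y`
is bounded by `1` on `Y` and has derivative at least `M` in modulus. -/
def HasLargeDerivatives (M : ℝ) (Y : Set ℂ) : Prop :=
  ∀ a ∈ Y, ∃ (T : Finset ℂ) (c : ℂ → ℂ), (∀ b ∈ T, b ∉ Y) ∧
    (∀ z ∈ Y, ‖∑ b ∈ T, c b / (z - b)‖ ≤ 1) ∧ M ≤ ‖∑ b ∈ T, c b / (a - b) ^ 2‖

/-- A single pole, close to `a` but at a comparable distance from `Y`, gives a large derivative. -/
theorem exists_largeDerivative_of_pole {M ρ : ℝ} (hρ : 0 < ρ) (hM : M * (4 * ρ) ≤ 1) {Y : Set ℂ}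
    {a p : ℂ} (ha : a ∈ Y) (hap : ‖a - p‖ ≤ 2 * ρ) (hY : ∀ z ∈ Y, ρ ≤ ‖z - p‖) :
    ∃ (T : Finset ℂ) (c : ℂ → ℂ), (∀ b ∈ T, b ∉ Y) ∧
      (∀ z ∈ Y, ‖∑ b ∈ T, c b / (z - b)‖ ≤ 1) ∧ M ≤ ‖∑ b ∈ T, c b / (a - b) ^ 2‖ := by
  refine ⟨{p}, fun _ => ρ, ?_, ?_, ?_⟩
  · intro b hb hbY
    rw [Finset.mem_singleton] at hb
    have := hY b hbY
    rw [hb, sub_self, norm_zero] at this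
    linarith
  · intro z hz
    rw [Finset.sum_singleton, norm_div, Complex.norm_real, Real.norm_of_nonneg hρ.le]
    exact div_le_one_of_le₀ (hY z hz) (norm_nonneg _)
  · rw [Finset.sum_singleton, norm_div, Complex.norm_real, Real.norm_of_nonneg hρ.le, norm_pow]
    have h := hρ.trans_le (hY a ha)
    rw [le_div_iff₀ (by positivity)]
    rcases le_or_gt M 0 with h0 | h0
    · exact (mul_nonpos_of_nonpos_of_nonneg h0 (by positivity)).trans hρ.le
    · calc M * ‖a - p‖ ^ 2 ≤ M * (2 * ρ) ^ 2 := by gcongr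
        _ = M * (4 * ρ) * ρ := by ring
        _ ≤ 1 * ρ := by gcongr
        _ = ρ := one_mul ρ

/-- A point on the ray from `x` through `a`, at distance `t` from `x`. -/
theorem exists_norm_sub_eq {a x : ℂ} (h : a ≠ x) {t : ℝ} (ht : 0 ≤ t) :
    ∃ p : ℂ, ‖p - x‖ = t ∧ ‖a - p‖ = |‖a - x‖ - t| := by
  have h0 : ‖a - x‖ ≠ 0 := norm_ne_zero_iff.2 (sub_ne_zero.2 h)
  refine ⟨x + (t / ‖a - x‖ : ℝ) * (a - x), ?_, ?_⟩
  · rw [add_sub_cancel_left, norm_mul, Complex.norm_real, Real.norm_of_nonneg (by positivity),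
      div_mul_cancel₀ _ h0]
  · have : a - (x + (t / ‖a - x‖ : ℝ) * (a - x)) = ((1 - t / ‖a - x‖ : ℝ) : ℂ) * (a - x) := by
      push_cast; ring
    rw [this, norm_mul, Complex.norm_real, Real.norm_eq_abs]
    nth_rewrite 2 [← abs_norm]
    rw [← abs_mul]
    congr 1
    field_simp

/-- If the lattice disks of radius `r` near `a` are all removed from `Y`, then a sum of poles at
their centres, with phases aligned at `a`, is bounded on `Y` and has a derivative at `a` of the
order of `N² r log K`. -/
theorem exists_largeDerivative_of_lattice {N K : ℕ} (hN : 0 < N) {r M : ℝ} (hr : 0 < r)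
    (hNr : 64 * (N ^ 2 * r) ≤ 1) (hM : M ≤ 4 / 9 * (N ^ 2 * r) * ∑ m ∈ Finset.Icc 1 K, 1 / (m : ℝ))
    {Y : Set ℂ} {a : ℂ} (ha : a ∈ Y) (hY1 : ∀ z ∈ Y, ‖z‖ ≤ 1)
    (hP : ∀ p ∈ nearbyIndices N K a, ‖latticePoint N p‖ ≤ 1)
    (hY : ∀ p ∈ nearbyIndices N K a, ∀ z ∈ Y, r ≤ ‖z - latticePoint N p‖) :
    ∃ (T : Finset ℂ) (c : ℂ → ℂ), (∀ b ∈ T, b ∉ Y) ∧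
      (∀ z ∈ Y, ‖∑ b ∈ T, c b / (z - b)‖ ≤ 1) ∧ M ≤ ‖∑ b ∈ T, c b / (a - b) ^ 2‖ := by
  have hinj : ∀ x ∈ nearbyIndices N K a, ∀ y ∈ nearbyIndices N K a,
      latticePoint N x = latticePoint N y → x = y := fun x _ y _ h => latticePoint_injective hN h
  have hne : ∀ p ∈ nearbyIndices N K a, 0 < ‖a - latticePoint N p‖ :=
    fun p hp => hr.trans_le (hY p hp a ha)
  refine ⟨(nearbyIndices N K a).image (latticePoint N),
    fun b => ((r / 2 / ‖a - b‖ ^ 2 : ℝ) : ℂ) * (a - b) ^ 2, ?_, ?_, ?_⟩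
  · intro b hb hbY
    obtain ⟨p, hp, rfl⟩ := Finset.mem_image.1 hb
    have := hY p hp _ hbY
    rw [sub_self, norm_zero] at this
    linarith
  · intro z hz
    rw [Finset.sum_image hinj]
    calc _ ≤ ∑ p ∈ nearbyIndices N K a, (1 / 2) * (r / ‖z - latticePoint N p‖) := by
          refine norm_sum_le_of_le _ fun p hp => le_of_eq ?_
          have := hne p hp
          rw [norm_div, norm_mul, Complex.norm_real, norm_pow, Real.norm_of_nonneg (by positivity)]
          field_simp
      _ ≤ (1 / 2) * (1 + 64 * N ^ 2 * r) := by
          rw [← Finset.mul_sum]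
          gcongr
          exact sum_div_norm_sub_latticePoint_le hN (hY1 z hz) hr.le _ hP
            fun p hp => hY p hp z hz
      _ ≤ 1 := by linarith
  · rw [Finset.sum_image hinj]
    have h : ∀ p ∈ nearbyIndices N K a,
        ((r / 2 / ‖a - latticePoint N p‖ ^ 2 : ℝ) : ℂ) * (a - latticePoint N p) ^ 2 /
          (a - latticePoint N p) ^ 2 =
        ((1 / 2 * (r / ‖a - latticePoint N p‖ ^ 2) : ℝ) : ℂ) := by
      intro p hp
      have := norm_pos_iff.1 (hne p hp)
      rw [mul_div_cancel_right₀ _ (pow_ne_zero _ this)]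
      congr 1
      ring
    rw [Finset.sum_congr rfl h, ← Complex.ofReal_sum, ← Finset.mul_sum, Complex.norm_real]
    refine le_trans ?_ (le_abs_self _)
    have := le_sum_div_norm_sub_latticePoint_sq hN K a hr fun p hp => hY p hp a ha
    linarith

open Classical in
/-- The new holes: disks of radius `r` at all lattice points at distance at least `ρ / 2` from the
unit circle and outside the old holes. -/
noncomputable def latticeHoles (H : Finset (ℂ × ℝ≥0)) (ρ : ℝ) (N : ℕ) (r : ℝ≥0) :
    Finset (ℂ × ℝ≥0) :=
  ((Finset.Icc (-(N : ℤ)) N ×ˢ Finset.Icc (-(N : ℤ)) N).filter fun p =>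
    ‖latticePoint N p‖ ≤ 1 - ρ / 2 ∧ ∀ x ∈ H, (x.2 : ℝ) + r < dist (latticePoint N p) x.1).image
    fun p => (latticePoint N p, r)

theorem mem_latticeHoles {H : Finset (ℂ × ℝ≥0)} {ρ : ℝ} {N : ℕ} {r : ℝ≥0} {x : ℂ × ℝ≥0}
    (hx : x ∈ latticeHoles H ρ N r) : ∃ p : ℤ × ℤ, x = (latticePoint N p, r) ∧
      ‖latticePoint N p‖ ≤ 1 - ρ / 2 ∧ ∀ y ∈ H, (y.2 : ℝ) + r < dist (latticePoint N p) y.1 := by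
  classical
  rw [latticeHoles, Finset.mem_image] at hx
  obtain ⟨p, hp, rfl⟩ := hx
  exact ⟨p, rfl, (Finset.mem_filter.1 hp).2⟩

theorem sum_latticeHoles_le {H : Finset (ℂ × ℝ≥0)} {ρ : ℝ} (hρ : 0 < ρ) {N : ℕ} (hN : 0 < N)
    {r : ℝ≥0} (hr : (r : ℝ) ≤ ρ / 4) :
    ∑ x ∈ latticeHoles H ρ N r, (x.2 : ℝ) / (1 - ‖x.1‖ - x.2) ^ 2 ≤
      144 * (N ^ 2 * r) / ρ ^ 2 := by
  classical
  have hterm : ∀ x ∈ latticeHoles H ρ N r, (x.2 : ℝ) / (1 - ‖x.1‖ - x.2) ^ 2 ≤ r / (ρ / 4) ^ 2 := by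
    intro x hx
    obtain ⟨p, rfl, hp, -⟩ := mem_latticeHoles hx
    simp only
    gcongr
    linarith
  have hcard : ((latticeHoles H ρ N r).card : ℝ) ≤ 9 * N ^ 2 := by
    have h : (latticeHoles H ρ N r).card ≤ (2 * N + 1) * (2 * N + 1) := by
      refine Finset.card_image_le.trans ((Finset.card_filter_le _ _).trans ?_)
      rw [Finset.card_product, Int.card_Icc]
      apply le_of_eq
      congr 1 <;> omega
    have h1 : (1 : ℝ) ≤ N := by exact_mod_cast hN
    calc ((latticeHoles H ρ N r).card : ℝ) ≤ ((2 * N + 1) * (2 * N + 1) : ℕ) := by exact_mod_cast h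
      _ ≤ 9 * N ^ 2 := by push_cast; nlinarith
  refine (Finset.sum_le_card_nsmul _ _ _ hterm).trans ?_
  rw [nsmul_eq_mul]
  calc _ ≤ 9 * (N : ℝ) ^ 2 * (r / (ρ / 4) ^ 2) := by gcongr
    _ = 144 * (N ^ 2 * r) / ρ ^ 2 := by field_simp; ring

/-- Every admissible family can be enlarged, within the same bound `C`, so that all points of its
complement carry derivatives at least `M`. -/
theorem IsAdmissible.exists_superset {C : ℝ} {H : Finset (ℂ × ℝ≥0)} (hH : IsAdmissible C H)
    (M : ℝ) : ∃ G, H ⊆ G ∧ IsAdmissible C G ∧ HasLargeDerivatives M (holeComplement G) := by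
  classical
  obtain ⟨ρ, hρ, hρ1, hρM, hρH⟩ : ∃ ρ : ℝ, 0 < ρ ∧ ρ ≤ 1 / 2 ∧ M * (4 * ρ) ≤ 1 ∧
      ∀ x ∈ H, ρ ≤ x.2 := by
    have h1 : ∀ᶠ ρ : ℝ in nhdsWithin 0 (Set.Ioi 0), ρ ≤ 1 / 2 :=
      nhdsWithin_le_nhds (eventually_le_nhds (by norm_num))
    have h2 : ∀ᶠ ρ : ℝ in nhdsWithin 0 (Set.Ioi 0), M * (4 * ρ) ≤ 1 := by
      refine nhdsWithin_le_nhds ?_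
      have : Filter.Tendsto (fun ρ : ℝ => M * (4 * ρ)) (nhds 0) (nhds (M * (4 * 0))) := by
        apply Continuous.tendsto; fun_prop
      exact this.eventually (eventually_le_nhds (by norm_num))
    have h3 : ∀ᶠ ρ : ℝ in nhdsWithin 0 (Set.Ioi 0), ∀ x ∈ H, ρ ≤ x.2 := by
      rw [Filter.eventually_all_finset]
      exact fun x hx => nhdsWithin_le_nhds (eventually_le_nhds (by exact_mod_cast hH.pos x hx))
    obtain ⟨ρ, ⟨⟨h1, h2⟩, h3⟩, h4⟩ := (((h1.and h2).and h3).and self_mem_nhdsWithin).exists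
    exact ⟨ρ, h4, h1, h2, h3⟩
  set η := C - ∑ x ∈ H, (x.2 : ℝ) / (1 - ‖x.1‖ - x.2) ^ 2 with hη
  have hη0 : 0 < η := sub_pos.2 hH.sum_lt
  obtain ⟨ε, hε, hε1, hε2⟩ : ∃ ε : ℝ, 0 < ε ∧ 64 * ε ≤ 1 ∧ 144 * ε / ρ ^ 2 < η := by
    refine ⟨min (1 / 64) (η * ρ ^ 2 / 288), by positivity, ?_, ?_⟩
    · linarith [min_le_left (1 / 64 : ℝ) (η * ρ ^ 2 / 288)]
    · rw [div_lt_iff₀ (by positivity)]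
      have := min_le_right (1 / 64 : ℝ) (η * ρ ^ 2 / 288)
      have : 0 < η * ρ ^ 2 := by positivity
      linarith
  -- The total area density `ε` is fixed; the mesh is refined until the harmonic sum is large.
  obtain ⟨K, hK⟩ : ∃ K : ℕ, M ≤ 4 / 9 * ε * ∑ m ∈ Finset.Icc 1 K, 1 / (m : ℝ) := by
    obtain ⟨K, hK⟩ := (Real.tendsto_sum_range_one_div_nat_succ_atTop.eventually_ge_atTop
      (M / (4 / 9 * ε))).exists
    refine ⟨K, ?_⟩
    rw [div_le_iff₀ (by positivity)] at hK
    have hsum : ∑ i ∈ Finset.range K, 1 / ((i : ℝ) + 1) = ∑ m ∈ Finset.Icc 1 K, 1 / (m : ℝ) := by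
      have := Finset.sum_Ico_add' (fun m : ℕ => 1 / (m : ℝ)) 0 K 1
      rw [zero_add, Finset.Ico_add_one_right_eq_Icc, ← Finset.range_eq_Ico] at this
      exact_mod_cast this
    rwa [hsum, mul_comm] at hK
  obtain ⟨N, hN⟩ := exists_nat_ge (max 1 (6 * (K + 1) / ρ))
  have hN1 : (1 : ℝ) ≤ N := (le_max_left _ _).trans hN
  have hN0 : 0 < N := by exact_mod_cast zero_lt_one.trans_le hN1
  have hNρ : 6 * (K + 1) ≤ N * ρ := (div_le_iff₀ hρ).1 ((le_max_right _ _).trans hN)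
  obtain ⟨r, hr⟩ : ∃ r : ℝ≥0, (r : ℝ) = ε / N ^ 2 := ⟨⟨ε / N ^ 2, by positivity⟩, rfl⟩
  have hr0 : (0 : ℝ) < r := by rw [hr]; positivity
  have hNr : (N : ℝ) ^ 2 * r = ε := by rw [hr]; field_simp
  have hrN : (r : ℝ) * 64 ≤ 1 / N := by
    rw [le_div_iff₀ (by positivity)]
    nlinarith
  have hN6 : 1 / (N : ℝ) ≤ ρ / 6 := by
    rw [div_le_div_iff₀ (by positivity) (by norm_num)]
    have : (0 : ℝ) ≤ K := Nat.cast_nonneg K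
    linarith
  have hKN : 3 * (K : ℝ) / N ≤ ρ / 2 := by
    rw [div_le_div_iff₀ (by positivity) (by norm_num)]
    linarith
  have hrρ : (r : ℝ) < ρ / 4 := by linarith
  refine ⟨H ∪ latticeHoles H ρ N r, Finset.subset_union_left, ⟨?_, ?_, ?_, ?_⟩, ?_⟩
  · intro x hx
    rcases Finset.mem_union.1 hx with hx | hx
    · exact hH.pos x hx
    · obtain ⟨p, rfl, -⟩ := mem_latticeHoles hx
      exact_mod_cast hr0
  · intro x hx
    rcases Finset.mem_union.1 hx with hx | hx
    · exact hH.lt_one x hx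
    · obtain ⟨p, rfl, hp, -⟩ := mem_latticeHoles hx
      simp only
      linarith
  · have hHL : ∀ x ∈ H, ∀ y ∈ latticeHoles H ρ N r,
        Disjoint (Metric.closedBall x.1 (x.2 : ℝ)) (Metric.closedBall y.1 (y.2 : ℝ)) := by
      intro x hx y hy
      obtain ⟨p, rfl, -, hp⟩ := mem_latticeHoles hy
      apply Metric.closedBall_disjoint_closedBall
      rw [dist_comm]
      exact hp x hx
    intro x hx y hy hxy
    rcases Finset.mem_union.1 hx with hx | hx <;> rcases Finset.mem_union.1 hy with hy | hy
    · exact hH.disjoint x hx y hy hxy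
    · exact hHL x hx y hy
    · exact (hHL y hy x hx).symm
    · obtain ⟨p, rfl, -⟩ := mem_latticeHoles hx
      obtain ⟨q, rfl, -⟩ := mem_latticeHoles hy
      apply Metric.closedBall_disjoint_closedBall
      have hpq : p ≠ q := fun h => hxy (by rw [h])
      have := inv_le_dist_latticePoint hN0 hpq
      simp only
      linarith
  · have h1 := sum_latticeHoles_le (H := H) hρ hN0 hrρ.le
    rw [hNr] at h1
    have h2 : ∑ x ∈ H ∪ latticeHoles H ρ N r, (x.2 : ℝ) / (1 - ‖x.1‖ - x.2) ^ 2 ≤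
        ∑ x ∈ H, (x.2 : ℝ) / (1 - ‖x.1‖ - x.2) ^ 2 +
          ∑ x ∈ latticeHoles H ρ N r, (x.2 : ℝ) / (1 - ‖x.1‖ - x.2) ^ 2 := by
      rw [← Finset.sum_union_inter]
      refine le_add_of_nonneg_right (Finset.sum_nonneg fun x _ => by positivity)
    linarith
  · intro a ha
    have hYH : ∀ z ∈ holeComplement (H ∪ latticeHoles H ρ N r), ∀ x ∈ H, (x.2 : ℝ) ≤ ‖z - x.1‖ := by
      intro z hz x hx
      rw [← dist_eq_norm]
      exact hz.2 x (Finset.mem_union_left _ hx)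
    by_cases h1 : ∃ x ∈ H, dist a x.1 < x.2 + ρ
    · -- Near an old hole: a pole inside that hole, at depth `ρ`.
      obtain ⟨x, hx, hax⟩ := h1
      have hxpos : (0 : ℝ) < x.2 := by exact_mod_cast hH.pos x hx
      have hax' := hYH a ha x hx
      have hne : a ≠ x.1 := fun h => by
        rw [h, sub_self, norm_zero] at hax'
        linarith
      obtain ⟨p, hp1, hp2⟩ := exists_norm_sub_eq hne (sub_nonneg.2 (hρH x hx))
      rw [dist_eq_norm] at hax
      refine exists_largeDerivative_of_pole hρ hρM ha (p := p) ?_ ?_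
      · rw [hp2, abs_of_nonneg (by linarith)]
        linarith
      · intro z hz
        have := hYH z hz x hx
        have h3 := norm_sub_le_norm_sub_add_norm_sub z p x.1
        linarith
    push Not at h1
    by_cases h2 : 1 - ρ < ‖a‖
    · -- Near the unit circle: a pole outside the closed unit disk.
      have hne : a ≠ 0 := fun h => by
        rw [h, norm_zero] at h2
        linarith
      obtain ⟨p, hp1, hp2⟩ := exists_norm_sub_eq hne (t := 1 + ρ) (by linarith)
      rw [sub_zero] at hp1 hp2
      have ha1 := ha.1
      refine exists_largeDerivative_of_pole hρ hρM ha (p := p) ?_ ?_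
      · rw [hp2, abs_of_nonpos (by linarith)]
        linarith
      · intro z hz
        have h3 := norm_sub_norm_le p z
        rw [norm_sub_rev] at h3
        linarith [hz.1]
    · -- Elsewhere: all lattice points within `ρ / 2` of `a` are centres of new holes.
      push Not at h2
      have hnear : ∀ p ∈ nearbyIndices N K a, ‖a - latticePoint N p‖ ≤ ρ / 2 :=
        fun p hp => (norm_sub_le_of_mem_nearbyIndices hN0 hp).trans hKN
      have hin : ∀ p ∈ nearbyIndices N K a, ‖latticePoint N p‖ ≤ 1 - ρ / 2 := by
        intro p hp
        have h3 := norm_sub_norm_le (latticePoint N p) a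
        rw [norm_sub_rev] at h3
        linarith [hnear p hp]
      have hmem : ∀ p ∈ nearbyIndices N K a, (latticePoint N p, r) ∈ latticeHoles H ρ N r := by
        intro p hp
        refine Finset.mem_image_of_mem _ (Finset.mem_filter.2 ⟨?_, hin p hp, ?_⟩)
        · exact mem_Icc_of_norm_latticePoint_le_one hN0 (by linarith [hin p hp])
        · intro x hx
          have h3 := dist_triangle a (latticePoint N p) x.1
          have h4 := hnear p hp
          rw [← dist_eq_norm] at h4
          linarith [h1 x hx]
      refine exists_largeDerivative_of_lattice hN0 hr0 (by rw [hNr]; exact hε1)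
        (by rw [hNr]; exact hK) ha (fun z hz => hz.1) (fun p hp => by linarith [hin p hp]) ?_
      intro p hp z hz
      rw [← dist_eq_norm]
      exact hz.2 _ (Finset.mem_union_right _ (hmem p hp))

/-! ### Construction of the cheese -/

/-- The weight `s / (1 - ‖b‖ - s)²` of the hole with index `n`; when `s > 0`, the denominator is
the square of the distance from the hole to the unit circle. -/
noncomputable def holeWeight (A : AbstractSwissCheese) (n : ℕ) : ℝ :=
  radius A n / (1 - ‖center A n‖ - radius A n) ^ 2

theorem radius_nonneg (A : AbstractSwissCheese) (n : ℕ) : 0 ≤ radius A n := NNReal.coe_nonneg _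

theorem holeWeight_nonneg (A : AbstractSwissCheese) (n : ℕ) : 0 ≤ holeWeight A n :=
  div_nonneg (radius_nonneg A n) (sq_nonneg _)

/-- A classical Swiss cheese in the closed unit disk whose holes have total weight at most `C`. -/
structure IsSparse (C : ℝ) (A : AbstractSwissCheese) : Prop where
  center_zero : center A 0 = 0
  radius_zero : radius A 0 = 1
  lt_one : ∀ k ∈ significant A, ‖center A k‖ + radius A k < 1
  disjoint : ∀ k ∈ significant A, ∀ l ∈ significant A, l ≠ k →
    Disjoint (closedDisk A k) (closedDisk A l)
  sum_le : ∀ F : Finset ℕ, ∑ n ∈ F, holeWeight A (n + 1) ≤ C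

section

variable {C : ℝ} {H : ℕ → Finset (ℂ × ℝ≥0)}

theorem countable_exists_mem (H : ℕ → Finset (ℂ × ℝ≥0)) : {x | ∃ k, x ∈ H k}.Countable := by
  have : {x | ∃ k, x ∈ H k} = ⋃ k, (H k : Set (ℂ × ℝ≥0)) := by ext; simp
  rw [this]
  exact Set.countable_iUnion fun k => (H k).countable_toSet

/-- The abstract Swiss cheese in the unit disk whose holes are the elements of `⋃ₖ Hₖ`, each
occurring at exactly one index; the other indices carry the pair `(0, 0)`. -/
noncomputable def cheeseOfHoles (H : ℕ → Finset (ℂ × ℝ≥0)) : AbstractSwissCheese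
  | 0 => (0, 1)
  | n + 1 =>
    letI := (countable_exists_mem H).toEncodable
    ((Encodable.decode₂ {x | ∃ k, x ∈ H k} n).map Subtype.val).getD (0, 0)

theorem exists_cheeseOfHoles_eq {x : ℂ × ℝ≥0} (hx : ∃ k, x ∈ H k) :
    ∃ n, cheeseOfHoles H (n + 1) = x := by
  let := (countable_exists_mem H).toEncodable
  refine ⟨Encodable.encode (⟨x, hx⟩ : {x | ∃ k, x ∈ H k}), ?_⟩
  simp [cheeseOfHoles]

theorem cheeseOfHoles_of_radius_pos {n : ℕ} (h : 0 < radius (cheeseOfHoles H) (n + 1)) :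
    (∃ k, cheeseOfHoles H (n + 1) ∈ H k) ∧
      ∀ m, cheeseOfHoles H (m + 1) = cheeseOfHoles H (n + 1) → m = n := by
  let := (countable_exists_mem H).toEncodable
  have key : ∀ n, 0 < radius (cheeseOfHoles H) (n + 1) →
      ∃ x : {x | ∃ k, x ∈ H k}, cheeseOfHoles H (n + 1) = x ∧ Encodable.encode x = n := by
    intro n h
    rcases hx : Encodable.decode₂ {x | ∃ k, x ∈ H k} n with _ | x
    · simp [radius, cheeseOfHoles, hx] at h
    · refine ⟨x, by simp [cheeseOfHoles, hx], ?_⟩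
      exact Encodable.mem_decode₂.1 hx
  obtain ⟨x, hx, hxn⟩ := key n h
  refine ⟨hx ▸ x.2, fun m hm => ?_⟩
  obtain ⟨y, hy, hym⟩ := key m (by rw [radius, hm]; exact h)
  have : y = x := Subtype.ext (by rw [← hx, ← hy, hm])
  rw [← hym, ← hxn, this]

theorem isSparse_cheeseOfHoles (hmono : Monotone H) (hH : ∀ k, IsAdmissible C (H k)) :
    IsSparse C (cheeseOfHoles H) := by
  classical
  refine ⟨rfl, rfl, ?_, ?_, ?_⟩
  · rintro (_ | n) ⟨h1, h2⟩
    · exact absurd h1 (by norm_num)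
    obtain ⟨⟨k, hk⟩, -⟩ := cheeseOfHoles_of_radius_pos h2
    exact (hH k).lt_one _ hk
  · rintro (_ | n) ⟨h1, h2⟩ (_ | m) ⟨h3, h4⟩ hmn
    · exact absurd h1 (by norm_num)
    · exact absurd h1 (by norm_num)
    · exact absurd h3 (by norm_num)
    obtain ⟨⟨k, hk⟩, hk'⟩ := cheeseOfHoles_of_radius_pos h2
    obtain ⟨⟨l, hl⟩, -⟩ := cheeseOfHoles_of_radius_pos h4
    refine (hH (max k l)).disjoint _ (hmono (le_max_left k l) hk) _
      (hmono (le_max_right k l) hl) fun h => hmn ?_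
    rw [hk' m h.symm]
  · intro F
    set F' := F.filter fun n => 0 < radius (cheeseOfHoles H) (n + 1) with hF'
    have h1 : ∑ n ∈ F, holeWeight (cheeseOfHoles H) (n + 1) =
        ∑ n ∈ F', holeWeight (cheeseOfHoles H) (n + 1) := by
      refine (Finset.sum_filter_of_ne fun n _ hn => ?_).symm
      refine lt_of_le_of_ne (radius_nonneg _ _) fun h => hn ?_
      rw [holeWeight, ← h, zero_div]
    have hinj : ∀ m ∈ F', ∀ n ∈ F',
        cheeseOfHoles H (m + 1) = cheeseOfHoles H (n + 1) → m = n :=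
      fun m _ n hn h => (cheeseOfHoles_of_radius_pos (Finset.mem_filter.1 hn).2).2 m h
    have hex : ∀ n ∈ F', ∃ k, cheeseOfHoles H (n + 1) ∈ H k :=
      fun n hn => (cheeseOfHoles_of_radius_pos (Finset.mem_filter.1 hn).2).1
    choose! k hk using hex
    have hsub : F'.image (fun n => cheeseOfHoles H (n + 1)) ⊆ H (F'.sup k) := by
      intro x hx
      obtain ⟨n, hn, rfl⟩ := Finset.mem_image.1 hx
      exact hmono (Finset.le_sup hn) (hk n hn)
    rw [h1]
    calc _ = ∑ x ∈ F'.image (fun n => cheeseOfHoles H (n + 1)),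
          (x.2 : ℝ) / (1 - ‖x.1‖ - x.2) ^ 2 := (Finset.sum_image hinj).symm
      _ ≤ ∑ x ∈ H (F'.sup k), (x.2 : ℝ) / (1 - ‖x.1‖ - x.2) ^ 2 :=
          Finset.sum_le_sum_of_subset_of_nonneg hsub fun x _ _ => by positivity
      _ ≤ C := (hH _).sum_lt.le

theorem cheeseCarrier_cheeseOfHoles_subset (k : ℕ) :
    cheeseCarrier (cheeseOfHoles H) ⊆ holeComplement (H k) := by
  intro z hz
  refine ⟨by simpa [closedDisk, center, radius, cheeseOfHoles] using hz.1, fun x hx => ?_⟩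
  obtain ⟨n, hn⟩ := exists_cheeseOfHoles_eq ⟨k, hx⟩
  have h : z ∉ openDisk (cheeseOfHoles H) (n + 1) := fun h' => hz.2 (Set.mem_iUnion.2 ⟨n, h'⟩)
  rw [openDisk, center, radius, hn, Metric.mem_ball, not_lt] at h
  exact h

end

theorem HasLargeDerivatives.mono {M M' : ℝ} {Y Y' : Set ℂ} (h : HasLargeDerivatives M Y)
    (hM : M' ≤ M) (hY : Y' ⊆ Y) : HasLargeDerivatives M' Y' := by
  intro a ha
  obtain ⟨T, c, h1, h2, h3⟩ := h a (hY ha)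
  exact ⟨T, c, fun b hb hbY => h1 b hb (hY hbY), fun z hz => h2 z (hY hz), hM.trans h3⟩

/-- The union of a chain of admissible families, the `n`-th of which forces derivatives at least
`n`. -/
theorem exists_cheese {C : ℝ} (hC : 0 < C) : ∃ B : AbstractSwissCheese, IsSparse C B ∧
    (significant B).Nonempty ∧ ∀ M, HasLargeDerivatives M (cheeseCarrier B) := by
  -- Start with one hole: on the disk without holes the form `∮ f' g` is zero.
  obtain ⟨s, hs0, hs⟩ : ∃ s : ℝ≥0, 0 < s ∧ (s : ℝ) ≤ 1 / 2 ∧ (s : ℝ) ≤ C / 8 := by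
    have h : 0 < min (1 / 2) (C / 8) := by positivity
    refine ⟨(min (1 / 2) (C / 8)).toNNReal, Real.toNNReal_pos.2 h, ?_⟩
    rw [Real.coe_toNNReal _ h.le]
    exact ⟨min_le_left _ _, min_le_right _ _⟩
  have hs0' : (0 : ℝ) < s := by exact_mod_cast hs0
  have h0 : IsAdmissible C {((0 : ℂ), s)} := by
    refine ⟨by simpa using hs0, ?_, ?_, ?_⟩
    · simp only [Finset.mem_singleton, forall_eq, norm_zero]
      linarith
    · intro x hx y hy hxy
      rw [Finset.mem_singleton] at hx hy
      exact absurd (hx.trans hy.symm) hxy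
    · have h : (1 / 4 : ℝ) ≤ (1 - s) ^ 2 := by nlinarith
      rw [Finset.sum_singleton, norm_zero, sub_zero, div_lt_iff₀ (by linarith)]
      nlinarith
  have hstep : ∀ (H : {H // IsAdmissible C H}) (n : ℕ), ∃ G : {H // IsAdmissible C H},
      H.1 ⊆ G.1 ∧ HasLargeDerivatives n (holeComplement G.1) := by
    intro H n
    obtain ⟨G, h1, h2, h3⟩ := H.2.exists_superset n
    exact ⟨⟨G, h2⟩, h1, h3⟩
  choose next hsub hlarge using hstep
  let H : ℕ → {H // IsAdmissible C H} := fun n => Nat.rec ⟨_, h0⟩ (fun n G => next G n) n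
  have hmono : Monotone fun n => (H n).1 := monotone_nat_of_le_succ fun n => hsub (H n) n
  refine ⟨cheeseOfHoles fun n => (H n).1, isSparse_cheeseOfHoles hmono fun n => (H n).2, ?_, ?_⟩
  · obtain ⟨n, hn⟩ := exists_cheeseOfHoles_eq (H := fun n => (H n).1) (x := ((0 : ℂ), s))
      ⟨0, Finset.mem_singleton_self _⟩
    refine ⟨n + 1, by omega, ?_⟩
    rw [radius, hn]
    exact hs0'
  · intro M
    obtain ⟨n, hn⟩ := exists_nat_ge M
    exact (hlarge (H n) n).mono hn (cheeseCarrier_cheeseOfHoles_subset (n + 1))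

namespace IsSparse

variable {C : ℝ} {A : AbstractSwissCheese}

theorem exists_eq_succ_of_significant {k : ℕ} (hk : k ∈ significant A) : ∃ n, k = n + 1 :=
  ⟨k - 1, by have := hk.1; omega⟩

theorem norm_le_one (hA : IsSparse C A) {z : ℂ} (hz : z ∈ cheeseCarrier A) : ‖z‖ ≤ 1 := by
  have := hz.1
  rwa [closedDisk, hA.center_zero, hA.radius_zero, mem_closedBall_zero_iff] at this

theorem norm_lt_one_of_mem_closedDisk (hA : IsSparse C A) {k : ℕ} (hk : k ∈ significant A) {z : ℂ}
    (hz : z ∈ closedDisk A k) : ‖z‖ < 1 := by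
  have h1 := norm_sub_norm_le z (center A k)
  rw [closedDisk, mem_closedBall_iff_norm] at hz
  linarith [hA.lt_one k hk]

/-- A lower bound for the distance from a point of the unit circle to the hole with index `k`. -/
theorem le_norm_sub {k : ℕ} {w z : ℂ} (hw : ‖w‖ = 1)
    (hz : z ∈ closedDisk A k) : 1 - ‖center A k‖ - radius A k ≤ ‖z - w‖ := by
  have h1 := norm_sub_norm_le w (center A k)
  have h2 := norm_sub_le_norm_sub_add_norm_sub w z (center A k)
  rw [closedDisk, mem_closedBall_iff_norm] at hz
  rw [norm_sub_rev w z] at h2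
  linarith

theorem radius_le_holeWeight (hA : IsSparse C A) {k : ℕ} (hk : k ∈ significant A) :
    radius A k ≤ holeWeight A k := by
  have h := hA.lt_one k hk
  have h1 := norm_nonneg (center A k)
  have h2 := radius_nonneg A k
  exact le_div_self h2 (by apply pow_pos; linarith) (pow_le_one₀ (by linarith) (by linarith))

theorem radius_eq_zero {n : ℕ} (h : n + 1 ∉ significant A) : radius A (n + 1) = 0 :=
  (radius_nonneg A _).antisymm' (not_lt.1 fun h' => h ⟨by omega, h'⟩)

theorem summable_holeWeight (hA : IsSparse C A) : Summable fun n => holeWeight A (n + 1) :=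
  summable_of_sum_le (fun _ => holeWeight_nonneg _ _) hA.sum_le

theorem isClassical (hA : IsSparse C A) : IsClassical A where
  summable_radius := by
    refine hA.summable_holeWeight.of_nonneg_of_le (fun n => radius_nonneg _ _) fun n => ?_
    by_cases h : n + 1 ∈ significant A
    · exact hA.radius_le_holeWeight h
    · rw [radius_eq_zero h]
      exact holeWeight_nonneg _ _
  radius_zero_pos := by rw [hA.radius_zero]; norm_num
  closedDisk_subset := by
    intro k hk z hz
    rw [openDisk, hA.center_zero, hA.radius_zero, mem_ball_zero_iff]
    exact hA.norm_lt_one_of_mem_closedDisk hk hz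
  disjoint := hA.disjoint

theorem mem_cheeseCarrier_iff (hA : IsSparse C A) {z : ℂ} : z ∈ cheeseCarrier A ↔
    ‖z‖ ≤ 1 ∧ ∀ k ∈ significant A, z ∉ openDisk A k := by
  rw [cheeseCarrier, Set.mem_sdiff, closedDisk, hA.center_zero, hA.radius_zero,
    mem_closedBall_zero_iff, Set.mem_iUnion, not_exists]
  refine and_congr_right fun _ => ⟨fun h k hk => ?_, fun h n hn => ?_⟩
  · obtain ⟨n, rfl⟩ := exists_eq_succ_of_significant hk
    exact h n
  · exact h (n + 1) ⟨by omega, Metric.pos_of_mem_ball hn⟩ hn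

theorem sphere_subset (hA : IsSparse C A) : Metric.sphere (0 : ℂ) 1 ⊆ cheeseCarrier A := by
  intro z hz
  rw [mem_sphere_zero_iff_norm] at hz
  refine hA.mem_cheeseCarrier_iff.2 ⟨hz.le, fun k hk h => ?_⟩
  exact (hA.norm_lt_one_of_mem_closedDisk hk (Metric.ball_subset_closedBall h)).ne hz

/-- The boundary circle of a hole lies in the cheese, since the closed holes are disjoint. -/
theorem sphere_center_subset (hA : IsSparse C A) {k : ℕ} (hk : k ∈ significant A) :
    Metric.sphere (center A k) (radius A k) ⊆ cheeseCarrier A := by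
  intro z hz
  have hz' : z ∈ closedDisk A k := Metric.sphere_subset_closedBall hz
  refine hA.mem_cheeseCarrier_iff.2
    ⟨(hA.norm_lt_one_of_mem_closedDisk hk hz').le, fun l hl h => ?_⟩
  rcases eq_or_ne l k with rfl | hlk
  · exact (Metric.mem_ball.1 h).ne (Metric.mem_sphere.1 hz)
  · exact Set.disjoint_left.1 (hA.disjoint k hk l hl hlk) hz' (Metric.ball_subset_closedBall h)

theorem div_circleDist_sq_le (hA : IsSparse C A) (n : ℕ) :
    radius A (n + 1) / circleDist A (n + 1) ^ 2 ≤ holeWeight A (n + 1) := by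
  by_cases hk : n + 1 ∈ significant A
  · have hr := hk.2
    have h := hA.lt_one _ hk
    have hd : 1 - ‖center A (n + 1)‖ - radius A (n + 1) ≤ circleDist A (n + 1) := by
      rw [circleDist, if_pos hr]
      refine le_csInf ⟨_, Set.mem_image2_of_mem (Metric.mem_ball_self hr)
        (mem_sphere_zero_iff_norm.2 norm_one)⟩ ?_
      rintro _ ⟨z, hz, w, hw, rfl⟩
      rw [dist_eq_norm]
      exact le_norm_sub (mem_sphere_zero_iff_norm.1 hw) (Metric.ball_subset_closedBall hz)
    refine div_le_div_of_nonneg_left hr.le (pow_pos (by linarith) 2) ?_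
    exact pow_le_pow_left₀ (by linarith) hd 2
  · rw [radius_eq_zero hk, zero_div]
    exact holeWeight_nonneg _ _

theorem summable_div_circleDist_sq (hA : IsSparse C A) :
    Summable fun n => radius A (n + 1) / circleDist A (n + 1) ^ 2 :=
  hA.summable_holeWeight.of_nonneg_of_le
    (fun _ => div_nonneg (radius_nonneg _ _) (sq_nonneg _)) hA.div_circleDist_sq_le

theorem tsum_div_circleDist_sq_le (hA : IsSparse C A) :
    ∑' n, radius A (n + 1) / circleDist A (n + 1) ^ 2 ≤ C :=
  Real.tsum_le_of_sum_le (fun _ => div_nonneg (radius_nonneg _ _) (sq_nonneg _)) fun F =>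
    (Finset.sum_le_sum fun n _ => hA.div_circleDist_sq_le n).trans (hA.sum_le F)

end IsSparse

/-! ### Bounded point derivations -/

section

variable {X : TopologicalSpace.Compacts ℂ}

/-- The quotient of two polynomials, as an element of `C(X, ℂ)`. -/
noncomputable def quotientMap (p q : Polynomial ℂ) (hq : ∀ z : X, q.eval (z : ℂ) ≠ 0) :
    C(X, ℂ) where
  toFun z := p.eval (z : ℂ) / q.eval (z : ℂ)
  continuous_toFun := (p.continuous.comp continuous_subtype_val).div
    (q.continuous.comp continuous_subtype_val) hq

/-- The quotient of two polynomials, as an element of `R(X)`. -/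
noncomputable def quotient (p q : Polynomial ℂ) (hq : ∀ z : X, q.eval (z : ℂ) ≠ 0) :
    ratAlg X :=
  ⟨quotientMap p q hq, Subalgebra.le_topologicalClosure _ ⟨p, q, fun z => ⟨hq z, rfl⟩⟩⟩

/-- The coordinate function `z` in `R(X)`. -/
noncomputable def coordinate (X : TopologicalSpace.Compacts ℂ) : ratAlg X :=
  quotient Polynomial.X 1 (by simp)

theorem coordinate_apply (z : X) : (coordinate X : C(X, ℂ)) z = z := by
  simp [coordinate, quotient, quotientMap]

theorem eval_sub_ne_zero {b : ℂ} (hb : b ∉ X) (z : X) :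
    (Polynomial.X - Polynomial.C b).eval (z : ℂ) ≠ 0 := by
  rw [Polynomial.eval_sub, Polynomial.eval_X, Polynomial.eval_C]
  exact sub_ne_zero.2 fun h => hb (h ▸ z.2)

/-- The function `1 / (z - b)` in `R(X)`, for `b ∉ X`. -/
noncomputable def simplePole {b : ℂ} (hb : b ∉ X) : ratAlg X :=
  quotient 1 (Polynomial.X - Polynomial.C b) (eval_sub_ne_zero hb)

theorem simplePole_apply {b : ℂ} (hb : b ∉ X) (z : X) :
    (simplePole hb : C(X, ℂ)) z = 1 / (z - b) := by
  simp [simplePole, quotient, quotientMap]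

theorem simplePole_mul {b : ℂ} (hb : b ∉ X) :
    simplePole hb * (coordinate X - algebraMap ℂ _ b) = 1 := by
  ext z
  have := eval_sub_ne_zero hb z
  rw [Polynomial.eval_sub, Polynomial.eval_X, Polynomial.eval_C] at this
  change (simplePole hb : C(X, ℂ)) z * ((coordinate X : C(X, ℂ)) z - b) = 1
  rw [simplePole_apply, coordinate_apply]
  field_simp

theorem aeval_coordinate_apply (p : Polynomial ℂ) (z : X) :
    ((Polynomial.aeval (coordinate X) p : ratAlg X) : C(X, ℂ)) z = p.eval (z : ℂ) := by
  let ev : ratAlg X →ₐ[ℂ] ℂ :=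
    (ContinuousMap.evalAlgHom ℂ ℂ z).comp (ratAlg X).val
  have h : ev (Polynomial.aeval (coordinate X) p) = p.eval (ev (coordinate X)) := by
    rw [← Polynomial.aeval_algHom_apply, Polynomial.coe_aeval_eq_eval]
  have h2 : ev (coordinate X) = z := coordinate_apply z
  rw [h2] at h
  exact h

/-- The inclusion of `R₀(X)` into `R(X)`. -/
noncomputable def ratInclusion (X : TopologicalSpace.Compacts ℂ) : ratAlgZero X →ₐ[ℂ] ratAlg X :=
  Subalgebra.inclusion (Subalgebra.le_topologicalClosure (ratAlgZero X))

theorem denseRange_ratInclusion : DenseRange (ratInclusion X) := by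
  have h := denseRange_inclusion_iff
    (subset_closure : (ratAlgZero X : Set C(X, ℂ)) ⊆ closure (ratAlgZero X : Set C(X, ℂ)))
  exact h.2 subset_rfl

/-- A character of `R(X)` sends the coordinate function to a point of `X`. -/
theorem character_coordinate_mem (φ : ratAlg X →ₐ[ℂ] ℂ) : φ (coordinate X) ∈ X := by
  by_contra h
  have := congrArg φ (simplePole_mul h)
  rw [map_mul, map_sub, AlgHom.commutes, map_one] at this
  simp at this

variable {φ : ratAlg X →ₐ[ℂ] ℂ} {d : ratAlg X →L[ℂ] ℂ}

theorem derivation_one (hd : ∀ a b, d (a * b) = φ a * d b + d a * φ b) : d 1 = 0 := by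
  have := hd 1 1
  simpa using this

theorem derivation_simplePole (hd : ∀ a b, d (a * b) = φ a * d b + d a * φ b) {b : ℂ}
    (hb : b ∉ X) :
    d (simplePole hb) = -(d (coordinate X) / (φ (coordinate X) - b) ^ 2) := by
  have hne : φ (coordinate X) - b ≠ 0 :=
    sub_ne_zero.2 fun h => hb (h ▸ character_coordinate_mem φ)
  have h1 := congrArg d (simplePole_mul hb)
  have h2 := congrArg φ (simplePole_mul hb)
  rw [map_mul, map_sub, AlgHom.commutes, map_one] at h2
  rw [hd, map_sub, map_sub, AlgHom.commutes, derivation_one hd, Algebra.algebraMap_eq_smul_one,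
    map_smul, derivation_one hd, smul_zero, sub_zero] at h1
  change φ (simplePole hb) * (φ (coordinate X) - b) = 1 at h2
  change _ + d (simplePole hb) * (φ (coordinate X) - b) = 0 at h1
  rw [eq_div_of_mul_eq hne h2] at h1
  field_simp at h1 ⊢
  linear_combination h1

/-- A point derivation is determined by its value at the coordinate function. -/
theorem derivation_eq_zero (hd : ∀ a b, d (a * b) = φ a * d b + d a * φ b)
    (h0 : d (coordinate X) = 0) : d = 0 := by
  have hpoly : ∀ p : Polynomial ℂ, d (Polynomial.aeval (coordinate X) p) = 0 := by
    intro p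
    induction p using Polynomial.induction_on with
    | C c => rw [Polynomial.aeval_C, Algebra.algebraMap_eq_smul_one, map_smul, derivation_one hd,
        smul_zero]
    | add p q hp hq => rw [map_add, map_add, hp, hq, add_zero]
    | monomial n c h =>
      rw [pow_succ, ← mul_assoc, map_mul, Polynomial.aeval_X, hd, h, h0, mul_zero, zero_mul,
        add_zero]
  ext f
  refine denseRange_ratInclusion.induction_on
    (p := fun f => d f = 0) f (isClosed_eq d.continuous continuous_const) ?_
  rintro ⟨f, p, q, hf⟩
  set F := ratInclusion X ⟨f, p, q, hf⟩
  have hF : ∀ z : X, (F : C(X, ℂ)) z = p.eval (z : ℂ) / q.eval (z : ℂ) := fun z => (hf z).2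
  have h1 : Polynomial.aeval (coordinate X) q * F = Polynomial.aeval (coordinate X) p := by
    ext z
    change ((Polynomial.aeval (coordinate X) q : ratAlg X) : C(X, ℂ)) z * (F : C(X, ℂ)) z = _
    rw [aeval_coordinate_apply, aeval_coordinate_apply, hF, mul_div_cancel₀ _ (hf z).1]
  have h2 : quotient 1 q (fun z => (hf z).1) * Polynomial.aeval (coordinate X) q = 1 := by
    ext z
    change (1 : Polynomial ℂ).eval (z : ℂ) / q.eval (z : ℂ) *
      ((Polynomial.aeval (coordinate X) q : ratAlg X) : C(X, ℂ)) z = 1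
    rw [aeval_coordinate_apply, Polynomial.eval_one, one_div_mul_cancel (hf z).1]
  have h3 := congrArg d h1
  have h4 := congrArg φ h2
  rw [hd, hpoly, hpoly, zero_mul, add_zero] at h3
  rw [map_mul, map_one] at h4
  exact (mul_eq_zero.1 h3).resolve_left (right_ne_zero_of_mul_eq_one h4)

end

/-- Functions bounded by `1` with arbitrarily large derivatives at each point of `X` exclude
non-zero bounded point derivations on `R(X)`. -/
theorem hasNoBoundedPointDerivations_of_hasLargeDerivatives {X : TopologicalSpace.Compacts ℂ}
    (hX : ∀ M, HasLargeDerivatives M (X : Set ℂ)) : HasNoBoundedPointDerivations (ratAlg X) := by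
  classical
  intro φ d hd
  by_contra hne
  have hc : 0 < ‖d (coordinate X)‖ := norm_pos_iff.2 fun h => hne (derivation_eq_zero hd h)
  obtain ⟨T, c, hT, hbound, hlarge⟩ := hX ((‖d‖ + 1) / ‖d (coordinate X)‖) _
    (character_coordinate_mem φ)
  set f : ratAlg X := ∑ b ∈ T.attach, c b • simplePole (hT b b.2) with hf
  have hfX : ∀ z : X, (f : C(X, ℂ)) z = ∑ b ∈ T, c b / (z - b) := by
    intro z
    rw [← Finset.sum_attach T, hf]
    simp [simplePole_apply, div_eq_mul_inv]
  have hnorm : ‖f‖ ≤ 1 :=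
    (ContinuousMap.norm_le _ zero_le_one).2 fun z => (congrArg norm (hfX z)).trans_le (hbound z z.2)
  have hdf : d f = -(d (coordinate X) * ∑ b ∈ T, c b / (φ (coordinate X) - b) ^ 2) := by
    rw [← Finset.sum_attach T, hf, map_sum, Finset.mul_sum, ← Finset.sum_neg_distrib]
    refine Finset.sum_congr rfl fun b _ => ?_
    rw [map_smul, derivation_simplePole hd, smul_eq_mul]
    ring
  have h1 : ‖d f‖ ≤ ‖d‖ := (d.le_opNorm f).trans (mul_le_of_le_one_right (norm_nonneg d) hnorm)
  rw [hdf, norm_neg, norm_mul] at h1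
  rw [div_le_iff₀ hc] at hlarge
  linarith

/-! ### Splitting a rational function along the holes -/

open Filter Topology Bornology

theorem analyticAt_dslope {f : ℂ → ℂ} {p z : ℂ} (hf : AnalyticAt ℂ f z) :
    AnalyticAt ℂ (dslope f p) z := by
  rcases eq_or_ne z p with rfl | h
  · obtain ⟨s, hs⟩ := hf
    exact ⟨_, hs.has_fpower_series_dslope_fslope⟩
  · refine AnalyticAt.congr ?_ (dslope_eventuallyEq_slope_of_ne f h).symm
    have : slope f p = fun z => (f z - f p) / (z - p) := funext fun z => slope_def_field f p z
    rw [this]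
    exact (hf.sub analyticAt_const).div (analyticAt_id.sub analyticAt_const) (sub_ne_zero.2 h)

theorem dslope_add_div {f : ℂ → ℂ} {p z : ℂ} (h : z ≠ p) :
    dslope f p z + f p / (z - p) = f z / (z - p) := by
  rw [dslope_of_ne f h, slope_def_field, ← add_div, sub_add_cancel]

theorem tendsto_div_sub_cobounded {f : ℂ → ℂ} {c : ℂ} (hf : Tendsto f (cobounded ℂ) (𝓝 c))
    (p : ℂ) : Tendsto (fun z => f z / (z - p)) (cobounded ℂ) (𝓝 0) := by
  have := hf.mul (tendsto_inv₀_cobounded.comp (tendsto_sub_const_cobounded p))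
  rw [mul_zero] at this
  exact this

theorem tendsto_dslope_cobounded {f : ℂ → ℂ} (hf : Tendsto f (cobounded ℂ) (𝓝 0)) (p : ℂ) :
    Tendsto (dslope f p) (cobounded ℂ) (𝓝 0) := by
  have h1 := (tendsto_div_sub_cobounded hf p).sub
    (tendsto_div_sub_cobounded (tendsto_const_nhds (x := f p)) p)
  rw [sub_zero] at h1
  refine h1.congr' ?_
  filter_upwards [eventually_ne_cobounded p] with z hz
  rw [← dslope_add_div hz, add_sub_cancel_right]

/-- `f` splits on the cheese as `f₀ + ∑ hₖ`, where `f₀` is analytic on the closed unit disk and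
`hₖ` is analytic off the `k`-th hole and vanishes at infinity. -/
def HasHoleDecomposition (A : AbstractSwissCheese) (f : ℂ → ℂ) : Prop :=
  ∃ (F : Finset ℕ) (f₀ : ℂ → ℂ) (h : ℕ → ℂ → ℂ), (∀ k ∈ F, k ∈ significant A) ∧
    AnalyticOnNhd ℂ f₀ (Metric.closedBall 0 1) ∧
    (∀ k ∈ F, AnalyticOnNhd ℂ (h k) (openDisk A k)ᶜ ∧ Tendsto (h k) (cobounded ℂ) (𝓝 0)) ∧
    ∀ z ∈ cheeseCarrier A, f z = f₀ z + ∑ k ∈ F, h k z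

namespace HasHoleDecomposition

variable {C : ℝ} {A : AbstractSwissCheese} {f g : ℂ → ℂ}

theorem congr (hf : HasHoleDecomposition A f) (h : ∀ z ∈ cheeseCarrier A, g z = f z) :
    HasHoleDecomposition A g := by
  obtain ⟨F, f₀, u, h1, h2, h3, h4⟩ := hf
  exact ⟨F, f₀, u, h1, h2, h3, fun z hz => (h z hz).trans (h4 z hz)⟩

/-- Dividing by `z - p`, where `p` lies outside the closed unit disk, replaces each hole part `h` by
its difference quotient at `p`; the polar parts `h(p) / (z - p)` are analytic on the disk. -/
theorem div_sub_of_one_lt (hA : IsSparse C A) (hf : HasHoleDecomposition A f) {p : ℂ}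
    (hp : 1 < ‖p‖) : HasHoleDecomposition A fun z => f z / (z - p) := by
  obtain ⟨F, f₀, h, h1, h2, h3, h4⟩ := hf
  have hne : ∀ z : ℂ, ‖z‖ ≤ 1 → z ≠ p := fun z hz h => by rw [← h] at hp; linarith
  refine ⟨F, fun z => (f₀ z + ∑ k ∈ F, h k p) / (z - p), fun k => dslope (h k) p, h1, ?_, ?_, ?_⟩
  · intro z hz
    refine ((h2 z hz).add analyticAt_const).div (analyticAt_id.sub analyticAt_const) ?_
    exact sub_ne_zero.2 (hne z (mem_closedBall_zero_iff.1 hz))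
  · exact fun k hk => ⟨fun z hz => analyticAt_dslope ((h3 k hk).1 z hz),
      tendsto_dslope_cobounded (h3 k hk).2 p⟩
  · intro z hz
    have hzp := hne z (hA.norm_le_one hz)
    simp only
    rw [h4 z hz, add_div, add_div, add_assoc, Finset.sum_div, Finset.sum_div,
      ← Finset.sum_add_distrib]
    congr 1
    refine Finset.sum_congr rfl fun k _ => ?_
    rw [add_comm, dslope_add_div hzp]

/-- The decomposition may be assumed to involve a given hole. -/
theorem insert_index (hf : HasHoleDecomposition A f) {n : ℕ} (hn : n ∈ significant A) :
    ∃ (F : Finset ℕ) (f₀ : ℂ → ℂ) (h : ℕ → ℂ → ℂ), n ∈ F ∧ (∀ k ∈ F, k ∈ significant A) ∧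
      AnalyticOnNhd ℂ f₀ (Metric.closedBall 0 1) ∧
      (∀ k ∈ F, AnalyticOnNhd ℂ (h k) (openDisk A k)ᶜ ∧ Tendsto (h k) (cobounded ℂ) (𝓝 0)) ∧
      ∀ z ∈ cheeseCarrier A, f z = f₀ z + ∑ k ∈ F, h k z := by
  obtain ⟨F, f₀, h, h1, h2, h3, h4⟩ := hf
  refine ⟨insert n F, f₀, fun k z => if k ∈ F then h k z else 0, Finset.mem_insert_self _ _,
    ?_, h2, ?_, ?_⟩
  · intro k hk
    rcases Finset.mem_insert.1 hk with rfl | hk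
    exacts [hn, h1 k hk]
  · intro k _
    by_cases hkF : k ∈ F
    · simpa only [if_pos hkF] using h3 k hkF
    · simp only [if_neg hkF]
      exact ⟨analyticOnNhd_const, tendsto_const_nhds⟩
  · intro z hz
    rw [h4 z hz]
    congr 1
    refine (Finset.sum_congr rfl fun k hk => (if_pos hk).symm).trans
      (Finset.sum_subset (Finset.subset_insert n F) fun k _ hk => if_neg hk)

theorem div_sub_of_mem_openDisk (hA : IsSparse C A) (hf : HasHoleDecomposition A f) {n : ℕ}
    (hn : n ∈ significant A) {p : ℂ} (hp : p ∈ openDisk A n) :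
    HasHoleDecomposition A fun z => f z / (z - p) := by
  obtain ⟨F, f₀, h, hnF, h1, h2, h3, h4⟩ := hf.insert_index hn
  have hne : ∀ z ∉ openDisk A n, z ≠ p := fun z hz h => hz (h ▸ hp)
  -- The polar part at `p` of all the other summands is moved to the summand of the `n`-th hole.
  set c := f₀ p + ∑ k ∈ F, h k p with hc
  refine ⟨F, dslope f₀ p, fun k z => dslope (h k) p z + if k = n then c / (z - p) else 0,
    h1, fun z hz => analyticAt_dslope (h2 z hz), ?_, ?_⟩
  · intro k hk
    by_cases hkn : k = n
    · subst hkn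
      simp only [if_true]
      constructor
      · intro z hz
        refine (analyticAt_dslope ((h3 k hk).1 z hz)).add ?_
        exact analyticAt_const.div (analyticAt_id.sub analyticAt_const) (sub_ne_zero.2 (hne z hz))
      · simpa using (tendsto_dslope_cobounded (h3 k hk).2 p).add
          (tendsto_div_sub_cobounded (tendsto_const_nhds (x := c)) p)
    · simp only [if_neg hkn, add_zero]
      exact ⟨fun z hz => analyticAt_dslope ((h3 k hk).1 z hz),
        tendsto_dslope_cobounded (h3 k hk).2 p⟩
  · intro z hz
    have hzp := hne z ((hA.mem_cheeseCarrier_iff.1 hz).2 n hn)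
    simp only
    rw [h4 z hz, Finset.sum_add_distrib, Finset.sum_ite_eq' F n fun _ => c / (z - p), if_pos hnF,
      hc, add_div, add_div, Finset.sum_div, Finset.sum_div, ← dslope_add_div hzp,
      ← Finset.sum_congr rfl fun k _ => dslope_add_div (f := h k) hzp, Finset.sum_add_distrib]
    ring

theorem div_sub (hA : IsSparse C A) (hf : HasHoleDecomposition A f) {p : ℂ}
    (hp : p ∉ cheeseCarrier A) : HasHoleDecomposition A fun z => f z / (z - p) := by
  rw [hA.mem_cheeseCarrier_iff, not_and_or, not_le] at hp
  rcases hp with hp | hp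
  · exact hf.div_sub_of_one_lt hA hp
  · push Not at hp
    obtain ⟨n, hn, hpn⟩ := hp
    exact hf.div_sub_of_mem_openDisk hA hn hpn

end HasHoleDecomposition

/-- Rational functions with poles off the cheese split along the holes, by induction on the zeros
of the denominator. -/
theorem hasHoleDecomposition_rational {C : ℝ} {A : AbstractSwissCheese} (hA : IsSparse C A)
    (p q : Polynomial ℂ) (hq : ∀ z ∈ cheeseCarrier A, q.eval z ≠ 0) :
    HasHoleDecomposition A fun z => p.eval z / q.eval z := by
  have key : ∀ m : Multiset ℂ, (∀ b ∈ m, b ∉ cheeseCarrier A) →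
      HasHoleDecomposition A fun z => p.eval z / q.leadingCoeff / (m.map fun b => z - b).prod := by
    intro m
    induction m using Multiset.induction_on with
    | empty =>
      intro _
      refine ⟨∅, fun z => p.eval z / q.leadingCoeff, 0, by simp, ?_, by simp, by simp⟩
      intro z _
      simp only [div_eq_mul_inv]
      exact (p.differentiable.analyticAt z).mul analyticAt_const
    | cons b m ih =>
      intro h
      have h1 := ih fun c hc => h c (Multiset.mem_cons_of_mem hc)
      refine (h1.div_sub hA (h b (Multiset.mem_cons_self b m))).congr fun z _ => ?_
      rw [Multiset.map_cons, Multiset.prod_cons, div_div _ _ (z - b), mul_comm (z - b)]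
  refine (key q.roots fun b hb hbX => hq b hbX (Polynomial.isRoot_of_mem_roots hb)).congr
    fun z _ => ?_
  have h := congrArg (Polynomial.eval z) (IsAlgClosed.splits q).eq_prod_roots
  rw [Polynomial.eval_mul, Polynomial.eval_C, Polynomial.eval_multiset_prod,
    Multiset.map_map] at h
  rw [h, div_div]
  simp

/-! ### Cauchy estimates outside a hole -/

open Real in
/-- Cauchy's integral formula for the exterior of a disk. -/
theorem circleIntegral_div_sub_of_exterior {h : ℂ → ℂ} {b w : ℂ} {s : ℝ} (hs : 0 < s)
    (hh : AnalyticOnNhd ℂ h (Metric.ball b s)ᶜ) (h0 : Tendsto h (cobounded ℂ) (𝓝 0))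
    (hw : s < ‖w - b‖) :
    (∮ z in C(b, s), h z / (z - w)) = -(2 * π * Complex.I) * h w := by
  have hcont : ContinuousOn h (Metric.ball b s)ᶜ := hh.continuousOn
  have hsub : ∀ R, s ≤ R → Metric.sphere b R ⊆ (Metric.ball b s)ᶜ := by
    intro R hR z hz hz'
    rw [Metric.mem_sphere] at hz
    rw [Metric.mem_ball] at hz'
    linarith
  have hne : ∀ R, R ≠ ‖w - b‖ → ∀ z ∈ Metric.sphere b R, z ≠ w := by
    intro R hR z hz hzw
    rw [hzw, mem_sphere_iff_norm] at hz
    exact hR hz.symm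
  have hinv : ∀ R, R ≠ ‖w - b‖ → ContinuousOn (fun z => (z - w)⁻¹) (Metric.sphere b R) :=
    fun R hR => (continuousOn_id.sub continuousOn_const).inv₀ fun z hz =>
      sub_ne_zero.2 (hne R hR z hz)
  have hds : ∀ R, s ≤ R → R ≠ ‖w - b‖ → (∮ z in C(b, R), dslope h w z) =
      (∮ z in C(b, R), h z / (z - w)) - h w * ∮ z in C(b, R), (z - w)⁻¹ := by
    intro R hR hR'
    have hR0 : 0 ≤ R := hs.le.trans hR
    rw [← circleIntegral.integral_const_mul, ← circleIntegral.integral_sub]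
    · refine circleIntegral.integral_congr hR0 fun z hz => ?_
      rw [← dslope_add_div (hne R hR' z hz), div_eq_mul_inv (h w), add_sub_cancel_right]
    · refine ContinuousOn.circleIntegrable hR0 ?_
      simp only [div_eq_mul_inv]
      exact (hcont.mono (hsub R hR)).mul (hinv R hR')
    · exact ContinuousOn.circleIntegrable hR0 (continuousOn_const.mul (hinv R hR'))
  have hz0 : (∮ z in C(b, s), (z - w)⁻¹) = 0 := by
    have hne' : ∀ z ∈ Metric.closedBall b s, z - w ≠ 0 := by
      intro z hz hzw
      rw [sub_eq_zero.1 hzw, mem_closedBall_iff_norm] at hz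
      linarith
    refine Complex.circleIntegral_eq_zero_of_differentiable_on_off_countable hs.le
      Set.countable_empty ((continuousOn_id.sub continuousOn_const).inv₀ hne') fun z hz => ?_
    exact (differentiableAt_id.sub (differentiableAt_const w)).inv
      (hne' z (Metric.ball_subset_closedBall hz.1))
  have hR : ∀ R, ‖w - b‖ < R → (∮ z in C(b, R), h z / (z - w)) =
      (∮ z in C(b, s), h z / (z - w)) + 2 * π * Complex.I * h w := by
    intro R hR
    have h1 : (∮ z in C(b, R), dslope h w z) = ∮ z in C(b, s), dslope h w z := by
      refine Complex.circleIntegral_eq_of_differentiable_on_annulus_off_countable hs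
        (hw.trans hR).le Set.countable_empty ?_ ?_
      · exact fun z hz => (analyticAt_dslope (hh z hz.2)).continuousAt.continuousWithinAt
      · intro z hz
        exact (analyticAt_dslope (hh z fun h' =>
          hz.1.2 (Metric.ball_subset_closedBall h'))).differentiableAt
    have hwR : w ∈ Metric.ball b R := by rwa [mem_ball_iff_norm]
    rw [hds R (hw.trans hR).le hR.ne', hds s le_rfl hw.ne, hz0,
      circleIntegral.integral_sub_inv_of_mem_ball hwR] at h1
    linear_combination h1
  -- The integral over the circle of radius `R` is independent of `R` and tends to `0`.
  have hzero : (∮ z in C(b, s), h z / (z - w)) + 2 * π * Complex.I * h w = 0 := by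
    rw [← norm_le_zero_iff]
    refine le_of_forall_pos_le_add fun ε hε => ?_
    have hev : ∀ᶠ z in cobounded ℂ, ‖h z‖ < ε / (4 * π) := by
      have := h0.norm
      rw [norm_zero] at this
      exact this.eventually (gt_mem_nhds (by positivity))
    obtain ⟨r, -, hr⟩ := (hasBasis_cobounded_norm (E := ℂ)).eventually_iff.1 hev
    obtain ⟨R, hR1, hR2⟩ : ∃ R : ℝ, 2 * ‖w - b‖ < R ∧ r + ‖b‖ < R :=
      ⟨max (2 * ‖w - b‖) (r + ‖b‖) + 1, by linarith [le_max_left (2 * ‖w - b‖) (r + ‖b‖)],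
        by linarith [le_max_right (2 * ‖w - b‖) (r + ‖b‖)]⟩
    have hRpos : 0 < R := by linarith
    rw [← hR R (by linarith), zero_add]
    have : ‖∮ z in C(b, R), h z / (z - w)‖ ≤ 2 * π * R * (ε / (4 * π) / (R / 2)) := by
      refine circleIntegral.norm_integral_le_of_norm_le_const hRpos.le fun z hz => ?_
      rw [mem_sphere_iff_norm] at hz
      have h1 : R / 2 ≤ ‖z - w‖ := by
        have := norm_sub_le_norm_sub_add_norm_sub z w b
        linarith
      have h2 : ‖h z‖ < ε / (4 * π) := by
        refine hr ?_
        change r ≤ ‖z‖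
        have := norm_sub_le z b
        linarith
      rw [norm_div]
      gcongr
    refine this.trans (le_of_eq ?_)
    have := pi_pos
    field_simp
    ring
  linear_combination hzero

section

variable {h k : ℂ → ℂ} {b w w' : ℂ} {s m δ : ℝ}

open Real in
/-- Adding a function analytic on the closed disk does not change the exterior Cauchy integral. -/
theorem exterior_eq_circleIntegral (hs : 0 < s) (hh : AnalyticOnNhd ℂ h (Metric.ball b s)ᶜ)
    (h0 : Tendsto h (cobounded ℂ) (𝓝 0)) (hk : AnalyticOnNhd ℂ k (Metric.closedBall b s))
    (hw : s < ‖w - b‖) :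
    CircleIntegrable (fun z => (h z + k z) / (z - w)) b s ∧
    h w = -((2 * π * Complex.I : ℂ)⁻¹ • ∮ z in C(b, s), (h z + k z) / (z - w)) := by
  have hne : ∀ z ∈ Metric.closedBall b s, z - w ≠ 0 := by
    intro z hz hzw
    rw [sub_eq_zero.1 hzw, mem_closedBall_iff_norm] at hz
    linarith
  have hkd : ∀ z ∈ Metric.closedBall b s, DifferentiableAt ℂ (fun z => k z / (z - w)) z :=
    fun z hz => (hk z hz).differentiableAt.div
      (differentiableAt_id.sub (differentiableAt_const w)) (hne z hz)
  have hkc : ContinuousOn (fun z => k z / (z - w)) (Metric.closedBall b s) :=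
    fun z hz => (hkd z hz).continuousAt.continuousWithinAt
  have hhc : ContinuousOn (fun z => h z / (z - w)) (Metric.sphere b s) := by
    refine ContinuousOn.div (hh.continuousOn.mono fun z hz hz' => ?_)
      (continuousOn_id.sub continuousOn_const) fun z hz => hne z (Metric.sphere_subset_closedBall hz)
    exact (Metric.mem_ball.1 hz').ne (Metric.mem_sphere.1 hz)
  have hhi := hhc.circleIntegrable hs.le
  have hki := (hkc.mono Metric.sphere_subset_closedBall).circleIntegrable hs.le
  have hk0 : (∮ z in C(b, s), k z / (z - w)) = 0 :=
    Complex.circleIntegral_eq_zero_of_differentiable_on_off_countable hs.le Set.countable_empty hkc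
      fun z hz => hkd z (Metric.ball_subset_closedBall hz.1)
  simp only [add_div]
  refine ⟨hhi.add hki, ?_⟩
  rw [circleIntegral.integral_add hhi hki, hk0, add_zero,
    circleIntegral_div_sub_of_exterior hs hh h0 hw, smul_eq_mul]
  have : (2 * π * Complex.I : ℂ) ≠ 0 := Complex.two_pi_I_ne_zero
  field_simp

theorem norm_exterior_le (hs : 0 < s) (hh : AnalyticOnNhd ℂ h (Metric.ball b s)ᶜ)
    (h0 : Tendsto h (cobounded ℂ) (𝓝 0)) (hk : AnalyticOnNhd ℂ k (Metric.closedBall b s))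
    (hm : ∀ z ∈ Metric.sphere b s, ‖h z + k z‖ ≤ m) (hδ : 0 < δ) (hw : s < ‖w - b‖)
    (hδw : ∀ z ∈ Metric.sphere b s, δ ≤ ‖z - w‖) : ‖h w‖ ≤ s / δ * m := by
  rw [(exterior_eq_circleIntegral hs hh h0 hk hw).2, norm_neg]
  refine (circleIntegral.norm_two_pi_i_inv_smul_integral_le_of_norm_le_const (C := m / δ) hs.le
    fun z hz => ?_).trans (le_of_eq (by ring))
  have := hm z hz
  have h1 := (norm_nonneg _).trans this
  rw [norm_div]
  gcongr
  exact hδw z hz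

theorem norm_exterior_sub_le (hs : 0 < s) (hh : AnalyticOnNhd ℂ h (Metric.ball b s)ᶜ)
    (h0 : Tendsto h (cobounded ℂ) (𝓝 0)) (hk : AnalyticOnNhd ℂ k (Metric.closedBall b s))
    (hm : ∀ z ∈ Metric.sphere b s, ‖h z + k z‖ ≤ m) (hδ : 0 < δ) (hw : s < ‖w - b‖)
    (hw' : s < ‖w' - b‖) (hδw : ∀ z ∈ Metric.sphere b s, δ ≤ ‖z - w‖)
    (hδw' : ∀ z ∈ Metric.sphere b s, δ ≤ ‖z - w'‖) :
    ‖h w - h w'‖ ≤ s / δ ^ 2 * m * ‖w - w'‖ := by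
  obtain ⟨i1, e1⟩ := exterior_eq_circleIntegral hs hh h0 hk hw
  obtain ⟨i2, e2⟩ := exterior_eq_circleIntegral hs hh h0 hk hw'
  rw [e1, e2, neg_sub_neg, ← smul_sub, ← circleIntegral.integral_sub i2 i1]
  refine (circleIntegral.norm_two_pi_i_inv_smul_integral_le_of_norm_le_const
    (C := m * ‖w - w'‖ / (δ * δ)) hs.le fun z hz => ?_).trans (le_of_eq (by ring))
  have h1 := hδw z hz
  have h2 := hδw' z hz
  have h3 : z - w ≠ 0 := norm_pos_iff.1 (hδ.trans_le h1)
  have h4 : z - w' ≠ 0 := norm_pos_iff.1 (hδ.trans_le h2)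
  have h5 := hm z hz
  have h6 := (norm_nonneg _).trans h5
  have : (h z + k z) / (z - w') - (h z + k z) / (z - w) =
      (h z + k z) * (w' - w) / ((z - w') * (z - w)) := by
    field_simp
    ring
  rw [this, norm_div, norm_mul, norm_mul, norm_sub_rev w' w]
  gcongr

end

theorem IsSparse.sum_holeWeight_le {C : ℝ} {A : AbstractSwissCheese} (hA : IsSparse C A)
    {F : Finset ℕ} (hF : ∀ k ∈ F, k ∈ significant A) : ∑ k ∈ F, holeWeight A k ≤ C := by
  refine le_trans (le_of_eq ?_) (hA.sum_le (F.image Nat.pred))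
  have h1 : ∀ k ∈ F, k.pred + 1 = k := fun k hk => Nat.succ_pred_eq_of_pos (hF k hk).1
  rw [Finset.sum_image fun k hk l hl h => by rw [← h1 k hk, ← h1 l hl, h]]
  exact Finset.sum_congr rfl fun k hk => by rw [h1 k hk]

/-- On the unit circle, a rational function bounded by `m` on the cheese is the sum of a function
analytic on the closed disk and a function `G` that is bounded, together with its derivative,
by `C m`: the part of `f` that belongs to the `k`-th hole and its derivative have size at most
`m sₖ / dₖ²`. -/
theorem HasHoleDecomposition.exists_circle_decomposition {C m : ℝ} {A : AbstractSwissCheese}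
    (hA : IsSparse C A) {f : ℂ → ℂ} (hf : HasHoleDecomposition A f)
    (hm : ∀ z ∈ cheeseCarrier A, ‖f z‖ ≤ m) : ∃ f₀ G : ℂ → ℂ,
      AnalyticOnNhd ℂ f₀ (Metric.closedBall 0 1) ∧ AnalyticOnNhd ℂ G (Metric.sphere 0 1) ∧
      (∀ w ∈ Metric.sphere (0 : ℂ) 1, f w = f₀ w + G w) ∧
      (∀ w ∈ Metric.sphere (0 : ℂ) 1, ‖G w‖ ≤ C * m) ∧
      ∀ w ∈ Metric.sphere (0 : ℂ) 1, ∀ w' ∈ Metric.sphere (0 : ℂ) 1,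
        ‖G w - G w'‖ ≤ C * m * ‖w - w'‖ := by
  obtain ⟨F, f₀, h, hF, h1, h2, h3⟩ := hf
  have hm0 : 0 ≤ m := (norm_nonneg _).trans
    (hm 1 (hA.sphere_subset (mem_sphere_zero_iff_norm.2 norm_one)))
  have hnot : ∀ k ∈ F, ∀ z ∈ Metric.sphere (0 : ℂ) 1, z ∉ closedDisk A k := fun k hk z hz hzk =>
    (hA.norm_lt_one_of_mem_closedDisk (hF k hk) hzk).ne (mem_sphere_zero_iff_norm.1 hz)
  have hlt : ∀ k ∈ F, ∀ z ∈ Metric.sphere (0 : ℂ) 1, radius A k < ‖z - center A k‖ := by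
    intro k hk z hz
    rw [← not_le, ← mem_closedBall_iff_norm]
    exact hnot k hk z hz
  have hδ : ∀ k ∈ F, 0 < 1 - ‖center A k‖ - radius A k :=
    fun k hk => by linarith [hA.lt_one k (hF k hk)]
  have hδ1 : ∀ k ∈ F, 1 - ‖center A k‖ - radius A k ≤ 1 :=
    fun k hk => by linarith [norm_nonneg (center A k), radius_nonneg A k]
  have hδw : ∀ k, ∀ w ∈ Metric.sphere (0 : ℂ) 1, ∀ z ∈ Metric.sphere (center A k) (radius A k),
      1 - ‖center A k‖ - radius A k ≤ ‖z - w‖ := fun k w hw z hz =>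
    IsSparse.le_norm_sub (mem_sphere_zero_iff_norm.1 hw) (Metric.sphere_subset_closedBall hz)
  -- The summands of the other holes are analytic on the closed `k`-th hole.
  have hrest : ∀ k ∈ F, AnalyticOnNhd ℂ (fun z => f₀ z + ∑ l ∈ F.erase k, h l z)
      (Metric.closedBall (center A k) (radius A k)) := by
    intro k hk z hz
    refine (h1 z (mem_closedBall_zero_iff.2
      (hA.norm_lt_one_of_mem_closedDisk (hF k hk) hz).le)).add ?_
    refine Finset.analyticAt_fun_sum _ fun l hl => ?_
    obtain ⟨hlk, hl⟩ := Finset.mem_erase.1 hl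
    refine (h2 l hl).1 z fun hzl => ?_
    exact Set.disjoint_left.1 (hA.disjoint k (hF k hk) l (hF l hl) hlk) hz
      (Metric.ball_subset_closedBall hzl)
  have hbound : ∀ k ∈ F, ∀ z ∈ Metric.sphere (center A k) (radius A k),
      ‖h k z + (f₀ z + ∑ l ∈ F.erase k, h l z)‖ ≤ m := by
    intro k hk z hz
    have hzX := hA.sphere_center_subset (hF k hk) hz
    have : h k z + (f₀ z + ∑ l ∈ F.erase k, h l z) = f z := by
      rw [h3 z hzX, ← Finset.add_sum_erase F _ hk]
      ring
    rw [this]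
    exact hm z hzX
  refine ⟨f₀, fun z => ∑ k ∈ F, h k z, h1, ?_, ?_, ?_, ?_⟩
  · intro z hz
    refine Finset.analyticAt_fun_sum _ fun k hk => (h2 k hk).1 z fun hzk => ?_
    exact hnot k hk z hz (Metric.ball_subset_closedBall hzk)
  · exact fun w hw => h3 w (hA.sphere_subset hw)
  · intro w hw
    calc _ ≤ ∑ k ∈ F, holeWeight A k * m := by
          refine norm_sum_le_of_le _ fun k hk => ?_
          refine (norm_exterior_le (hF k hk).2 (h2 k hk).1 (h2 k hk).2 (hrest k hk) (hbound k hk)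
            (hδ k hk) (hlt k hk w hw) (hδw k w hw)).trans ?_
          refine mul_le_mul_of_nonneg_right ?_ hm0
          refine div_le_div_of_nonneg_left (radius_nonneg A k) (pow_pos (hδ k hk) 2) ?_
          exact pow_le_of_le_one (hδ k hk).le (hδ1 k hk) two_ne_zero
      _ ≤ C * m := by
          rw [← Finset.sum_mul]
          exact mul_le_mul_of_nonneg_right (hA.sum_holeWeight_le hF) hm0
  · intro w hw w' hw'
    simp only
    rw [← Finset.sum_sub_distrib]
    calc _ ≤ ∑ k ∈ F, holeWeight A k * m * ‖w - w'‖ := by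
          refine norm_sum_le_of_le _ fun k hk => ?_
          exact norm_exterior_sub_le (hF k hk).2 (h2 k hk).1 (h2 k hk).2 (hrest k hk) (hbound k hk)
            (hδ k hk) (hlt k hk w hw) (hlt k hk w' hw') (hδw k w hw) (hδw k w' hw')
      _ ≤ C * m * ‖w - w'‖ := by
          rw [← Finset.sum_mul, ← Finset.sum_mul]
          have := hA.sum_holeWeight_le hF
          gcongr

/-! ### The form `∫ u' v` on the circle -/

open Real

/-- The form `∫ u' v` over a period. For the restrictions of analytic functions `f`, `g` to the unit
circle it equals `∮ f'(z) g(z) dz`. -/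
noncomputable def circleForm (u v : ℝ → ℂ) : ℂ := ∫ θ in (0 : ℝ)..2 * π, deriv u θ * v θ

section

variable {u u' v v' : ℝ → ℂ}

theorem intervalIntegrable_deriv_mul (hu : ContDiff ℝ 1 u) (hv : ContDiff ℝ 1 v) :
    IntervalIntegrable (fun θ => deriv u θ * v θ) MeasureTheory.volume 0 (2 * π) :=
  ((hu.continuous_deriv le_rfl).mul hv.continuous).intervalIntegrable _ _

theorem differentiable_of_contDiff_one (hu : ContDiff ℝ 1 u) : Differentiable ℝ u :=
  hu.differentiable one_ne_zero

theorem circleForm_add_left (hu : ContDiff ℝ 1 u) (hu' : ContDiff ℝ 1 u') (hv : ContDiff ℝ 1 v) :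
    circleForm (u + u') v = circleForm u v + circleForm u' v := by
  rw [circleForm, circleForm, circleForm, ← intervalIntegral.integral_add
    (intervalIntegrable_deriv_mul hu hv) (intervalIntegrable_deriv_mul hu' hv)]
  refine intervalIntegral.integral_congr fun θ _ => ?_
  rw [deriv_add (differentiable_of_contDiff_one hu θ) (differentiable_of_contDiff_one hu' θ),
    add_mul]

theorem circleForm_add_right (hu : ContDiff ℝ 1 u) (hv : ContDiff ℝ 1 v) (hv' : ContDiff ℝ 1 v') :
    circleForm u (v + v') = circleForm u v + circleForm u v' := by
  rw [circleForm, circleForm, circleForm, ← intervalIntegral.integral_add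
    (intervalIntegrable_deriv_mul hu hv) (intervalIntegrable_deriv_mul hu hv')]
  refine intervalIntegral.integral_congr fun θ _ => ?_
  simp only [Pi.add_apply, mul_add]

theorem circleForm_smul_left (c : ℂ) (hu : ContDiff ℝ 1 u) :
    circleForm (c • u) v = c * circleForm u v := by
  rw [circleForm, circleForm, ← intervalIntegral.integral_const_mul]
  refine intervalIntegral.integral_congr fun θ _ => ?_
  rw [deriv_const_smul c (differentiable_of_contDiff_one hu θ), smul_eq_mul, mul_assoc]

theorem circleForm_smul_right (c : ℂ) : circleForm u (c • v) = c * circleForm u v := by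
  rw [circleForm, circleForm, ← intervalIntegral.integral_const_mul]
  refine intervalIntegral.integral_congr fun θ _ => ?_
  simp only [Pi.smul_apply, smul_eq_mul]
  ring

theorem circleForm_mul_left (hu : ContDiff ℝ 1 u) (hu' : ContDiff ℝ 1 u') (hv : ContDiff ℝ 1 v) :
    circleForm (u * u') v = circleForm u (u' * v) + circleForm u' (u * v) := by
  refine Eq.trans ?_ (intervalIntegral.integral_add
    (intervalIntegrable_deriv_mul hu (hu'.mul hv)) (intervalIntegrable_deriv_mul hu' (hu.mul hv)))
  refine intervalIntegral.integral_congr fun θ _ => ?_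
  rw [deriv_mul (differentiable_of_contDiff_one hu θ) (differentiable_of_contDiff_one hu' θ),
    Pi.mul_apply, Pi.mul_apply]
  ring

theorem circleForm_swap (hu : ContDiff ℝ 1 u) (hv : ContDiff ℝ 1 v) (hup : u (2 * π) = u 0)
    (hvp : v (2 * π) = v 0) : circleForm u v = -circleForm v u := by
  have h := intervalIntegral.integral_deriv_mul_eq_sub (a := 0) (b := 2 * π)
    (fun θ _ => (differentiable_of_contDiff_one hu θ).hasDerivAt)
    (fun θ _ => (differentiable_of_contDiff_one hv θ).hasDerivAt)
    ((hu.continuous_deriv le_rfl).intervalIntegrable _ _)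
    ((hv.continuous_deriv le_rfl).intervalIntegrable _ _)
  rw [hup, hvp, sub_self] at h
  simp only [mul_comm (u _)] at h
  rw [intervalIntegral.integral_add (intervalIntegrable_deriv_mul hu hv)
    (intervalIntegrable_deriv_mul hv hu)] at h
  exact eq_neg_of_add_eq_zero_left h

theorem norm_circleForm_le {a b : ℝ} (ha : ∀ θ, ‖deriv u θ‖ ≤ a) (hb : ∀ θ, ‖v θ‖ ≤ b) :
    ‖circleForm u v‖ ≤ a * b * (2 * π) := by
  have ha0 := (norm_nonneg _).trans (ha 0)
  refine (intervalIntegral.norm_integral_le_of_norm_le_const (C := a * b) fun θ _ => ?_).trans ?_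
  · rw [norm_mul]
    exact mul_le_mul (ha θ) (hb θ) (norm_nonneg _) ha0
  · rw [sub_zero, abs_of_pos two_pi_pos]

end

theorem circleMap_mem_unitSphere (θ : ℝ) : circleMap 0 1 θ ∈ Metric.sphere (0 : ℂ) 1 :=
  circleMap_mem_sphere 0 zero_le_one θ

theorem contDiff_comp_circleMap {f : ℂ → ℂ} (hf : AnalyticOnNhd ℂ f (Metric.sphere 0 1)) :
    ContDiff ℝ 1 fun θ => f (circleMap 0 1 θ) := by
  refine contDiff_iff_contDiffAt.2 fun θ => ?_
  have h := ((hf _ (circleMap_mem_unitSphere θ)).contDiffAt (n := 1)).restrict_scalars ℝ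
  exact h.comp θ (contDiff_circleMap 0 1).contDiffAt

/-- Cauchy's theorem `∮ f' g = 0` on the closed disk. -/
theorem circleForm_eq_zero {f g : ℂ → ℂ} (hf : AnalyticOnNhd ℂ f (Metric.closedBall 0 1))
    (hg : AnalyticOnNhd ℂ g (Metric.closedBall 0 1)) :
    circleForm (fun θ => f (circleMap 0 1 θ)) (fun θ => g (circleMap 0 1 θ)) = 0 := by
  have hd : AnalyticOnNhd ℂ (fun z => deriv f z * g z) (Metric.closedBall 0 1) := hf.deriv.mul hg
  have h := Complex.circleIntegral_eq_zero_of_differentiable_on_off_countable zero_le_one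
    Set.countable_empty hd.continuousOn
    fun z hz => (hd z (Metric.ball_subset_closedBall hz.1)).differentiableAt
  rw [circleIntegral] at h
  refine Eq.trans (intervalIntegral.integral_congr fun θ _ => ?_) h
  have h1 := ((hf _ (Metric.sphere_subset_closedBall
    (circleMap_mem_unitSphere θ))).differentiableAt.hasDerivAt.comp_of_eq θ
      (hasDerivAt_circleMap 0 1 θ) rfl)
  rw [deriv_circleMap]
  have h2 : deriv (fun θ => f (circleMap 0 1 θ)) θ = _ := h1.deriv
  rw [h2, smul_eq_mul]
  ring

theorem norm_deriv_comp_circleMap_le {f : ℂ → ℂ} {c : ℝ} (hc : 0 ≤ c)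
    (hf : ∀ w ∈ Metric.sphere (0 : ℂ) 1, ∀ w' ∈ Metric.sphere (0 : ℂ) 1,
      ‖f w - f w'‖ ≤ c * ‖w - w'‖) (θ : ℝ) :
    ‖deriv (fun θ => f (circleMap 0 1 θ)) θ‖ ≤ c := by
  refine norm_deriv_le_of_lip' hc (Eventually.of_forall fun t => ?_)
  refine (hf _ (circleMap_mem_unitSphere t) _ (circleMap_mem_unitSphere θ)).trans ?_
  have := (lipschitzWith_circleMap 0 1).dist_le_mul t θ
  rw [dist_eq_norm, dist_eq_norm] at this
  simp only [map_one, NNReal.coe_one, one_mul] at this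
  gcongr

/-- The form `∮ f' g` on rational functions is bounded for the uniform norms on the cheese. Of the
four terms obtained by splitting `f` and `g`, the one with both analytic parts vanishes, and
integration by parts moves the derivative in `∮ f₀' G` onto the hole part `G` of `g`. -/
theorem norm_circleForm_le_of_hasHoleDecomposition {C m n : ℝ} {A : AbstractSwissCheese}
    (hA : IsSparse C A) {f g : ℂ → ℂ} (hf : HasHoleDecomposition A f)
    (hg : HasHoleDecomposition A g) (hm : ∀ z ∈ cheeseCarrier A, ‖f z‖ ≤ m)
    (hn : ∀ z ∈ cheeseCarrier A, ‖g z‖ ≤ n) :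
    ‖circleForm (fun θ => f (circleMap 0 1 θ)) (fun θ => g (circleMap 0 1 θ))‖ ≤
      2 * π * C * (2 + C) * m * n := by
  obtain ⟨f₀, F, hf₀, hF, hfF, hFb, hFl⟩ := hf.exists_circle_decomposition hA hm
  obtain ⟨g₀, G, hg₀, hG, hgG, hGb, hGl⟩ := hg.exists_circle_decomposition hA hn
  have h1 : (1 : ℂ) ∈ Metric.sphere (0 : ℂ) 1 := mem_sphere_zero_iff_norm.2 norm_one
  have hFc := (norm_nonneg _).trans (hFb 1 h1)
  have hGc := (norm_nonneg _).trans (hGb 1 h1)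
  have e1 : (fun θ => f (circleMap 0 1 θ)) =
      (fun θ => f₀ (circleMap 0 1 θ)) + fun θ => F (circleMap 0 1 θ) :=
    funext fun θ => hfF _ (circleMap_mem_unitSphere θ)
  have e2 : (fun θ => g (circleMap 0 1 θ)) =
      (fun θ => g₀ (circleMap 0 1 θ)) + fun θ => G (circleMap 0 1 θ) :=
    funext fun θ => hgG _ (circleMap_mem_unitSphere θ)
  have c1 := contDiff_comp_circleMap (hf₀.mono Metric.sphere_subset_closedBall)
  have c2 := contDiff_comp_circleMap hF
  have c3 := contDiff_comp_circleMap (hg₀.mono Metric.sphere_subset_closedBall)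
  have c4 := contDiff_comp_circleMap hG
  have hper : ∀ u : ℂ → ℂ, u (circleMap 0 1 (2 * π)) = u (circleMap 0 1 0) := fun u => by
    rw [(periodic_circleMap 0 1).eq]
  have hsplit : circleForm (fun θ => f (circleMap 0 1 θ)) (fun θ => g (circleMap 0 1 θ)) =
      -circleForm (fun θ => G (circleMap 0 1 θ)) (fun θ => f₀ (circleMap 0 1 θ)) +
        circleForm (fun θ => F (circleMap 0 1 θ)) (fun θ => g (circleMap 0 1 θ)) := by
    have c5 : ContDiff ℝ 1 (fun θ => g (circleMap 0 1 θ)) := by rw [e2]; exact c3.add c4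
    rw [e1, circleForm_add_left c1 c2 c5]
    congr 1
    rw [e2, circleForm_add_right c1 c3 c4, circleForm_eq_zero hf₀ hg₀, zero_add,
      circleForm_swap c1 c4 (hper f₀) (hper G)]
  have b1 : ∀ θ, ‖f₀ (circleMap 0 1 θ)‖ ≤ m + C * m := by
    intro θ
    have hθ := circleMap_mem_unitSphere θ
    have h2 : f₀ (circleMap 0 1 θ) = f (circleMap 0 1 θ) - F (circleMap 0 1 θ) := by
      rw [hfF _ hθ, add_sub_cancel_right]
    rw [h2]
    exact (norm_sub_le _ _).trans (add_le_add (hm _ (hA.sphere_subset hθ)) (hFb _ hθ))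
  have b2 := norm_circleForm_le (norm_deriv_comp_circleMap_le hGc hGl) b1
  have b3 := norm_circleForm_le (norm_deriv_comp_circleMap_le hFc hFl)
    fun θ => hn _ (hA.sphere_subset (circleMap_mem_unitSphere θ))
  rw [hsplit]
  refine (norm_add_le _ _).trans ?_
  rw [norm_neg]
  refine (add_le_add b2 b3).trans (le_of_eq ?_)
  ring

/-! ### A derivation into the dual module -/

/-- A bounded bilinear form on a dense subspace extends to the whole space. -/
theorem exists_bilinear_extension {E₀ E : Type*} [NormedAddCommGroup E₀] [NormedSpace ℂ E₀]
    [NormedAddCommGroup E] [NormedSpace ℂ E] (ι : E₀ →ₗ[ℂ] E) (hι : DenseRange ι)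
    (hnorm : ∀ x, ‖ι x‖ = ‖x‖) (β : E₀ →ₗ[ℂ] E₀ →ₗ[ℂ] ℂ) (K : ℝ)
    (hK : ∀ x y, ‖β x y‖ ≤ K * ‖x‖ * ‖y‖) :
    ∃ D : E →L[ℂ] E →L[ℂ] ℂ, ∀ x y, D (ι x) (ι y) = β x y := by
  let B : E₀ →L[ℂ] E₀ →L[ℂ] ℂ := β.mkContinuous₂ K hK
  -- The form is extended in the first variable, then in the second one.
  let B₁ : E →L[ℂ] E₀ →L[ℂ] ℂ := B.toLinearMap.extendOfNorm ι
  have hB₁ : ∀ x, B₁ (ι x) = B x :=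
    LinearMap.extendOfNorm_eq hι ⟨‖B‖, fun x => (B.le_opNorm x).trans_eq (by rw [hnorm])⟩
  let B₂ : E →L[ℂ] E →L[ℂ] ℂ := B₁.flip.toLinearMap.extendOfNorm ι
  have hB₂ : ∀ y, B₂ (ι y) = B₁.flip y :=
    LinearMap.extendOfNorm_eq hι
      ⟨‖B₁.flip‖, fun y => (B₁.flip.le_opNorm y).trans_eq (by rw [hnorm])⟩
  refine ⟨B₂.flip, fun x y => ?_⟩
  rw [ContinuousLinearMap.flip_apply, hB₂, ContinuousLinearMap.flip_apply, hB₁]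
  rfl

/-- A bounded bilinear form `D` with `D(ab, c) = D(b, ac) + D(a, bc)` is a continuous derivation
into the dual module. -/
theorem not_isWeaklyAmenable_of_ne_zero {R : Type*} [NormedCommRing R] [NormedAlgebra ℂ R]
    (D : R →L[ℂ] R →L[ℂ] ℂ) (hD : ∀ a b c, D (a * b) c = D b (a * c) + D a (b * c))
    (h0 : D ≠ 0) : ¬ IsWeaklyAmenable R := by
  intro hW
  let act : R →L[ℂ] (R →L[ℂ] ℂ) →L[ℂ] (R →L[ℂ] ℂ) :=
    (ContinuousLinearMap.compL ℂ R R ℂ).flip.comp (ContinuousLinearMap.mul ℂ R)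
  have hact : ∀ a x b, act a x b = x (a * b) := fun a x b => rfl
  refine h0 (hW (R →L[ℂ] ℂ) act (fun a b x => ContinuousLinearMap.ext fun c => ?_) D
    fun a b => ContinuousLinearMap.ext fun c => ?_)
  · rw [hact, hact, hact, mul_comm a b, mul_assoc]
  · rw [add_apply, hact, hact, hD]

section

variable {X : TopologicalSpace.Compacts ℂ}

/-- A bounded bilinear form `β` on `R₀(X)` with `β(fg, h) = β(f, gh) + β(g, fh)` extends to a
continuous derivation from `R(X)` into its dual module, so `R(X)` is not weakly amenable if `β` is
non-zero. -/
theorem not_isWeaklyAmenable_of_form (β : ratAlgZero X →ₗ[ℂ] ratAlgZero X →ₗ[ℂ] ℂ) (K : ℝ)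
    (hK : ∀ f g, ‖β f g‖ ≤ K * ‖f‖ * ‖g‖)
    (hβ : ∀ f g h, β (f * g) h = β f (g * h) + β g (f * h)) {f₀ g₀ : ratAlgZero X}
    (h0 : β f₀ g₀ ≠ 0) : ¬ IsWeaklyAmenable (ratAlg X) := by
  let ι : ratAlgZero X →ₗ[ℂ] ratAlg X := (ratInclusion X).toLinearMap
  have hι : DenseRange ι := denseRange_ratInclusion
  have hιmul : ∀ f g, ι (f * g) = ι f * ι g := map_mul (ratInclusion X)
  obtain ⟨D, hD⟩ := exists_bilinear_extension ι hι (fun _ => rfl) β K hK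
  have hleib : ∀ a b c, D (a * b) c = D b (a * c) + D a (b * c) := by
    intro a b c
    refine hι.induction_on₃ (p := fun a b c => D (a * b) c = D b (a * c) + D a (b * c)) ?_ ?_ a b c
    · apply isClosed_eq <;> fun_prop
    · intro f g h
      rw [← hιmul, ← hιmul, ← hιmul, hD, hD, hD, hβ, add_comm]
  refine not_isWeaklyAmenable_of_ne_zero D hleib fun hD0 => h0 ?_
  rw [← hD, hD0]
  rfl

end

section

variable {C : ℝ} {A : AbstractSwissCheese}

/-- The restriction of a continuous function on the cheese to the unit circle, as a function of
the angle. -/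
noncomputable def circleTrace (hA : IsSparse C A) (f : C(cheeseSet A, ℂ)) (θ : ℝ) : ℂ :=
  f ⟨circleMap 0 1 θ, hA.sphere_subset (circleMap_mem_unitSphere θ)⟩

theorem exists_rational_extension (hA : IsSparse C A) (f : ratAlgZero (cheeseSet A)) :
    ∃ u : ℂ → ℂ, HasHoleDecomposition A u ∧ AnalyticOnNhd ℂ u (Metric.sphere 0 1) ∧
      (∀ z ∈ cheeseCarrier A, ‖u z‖ ≤ ‖f‖) ∧
      circleTrace hA f = fun θ => u (circleMap 0 1 θ) := by
  obtain ⟨f, p, q, hf⟩ := f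
  refine ⟨fun z => p.eval z / q.eval z, hasHoleDecomposition_rational hA p q
    fun z hz => (hf ⟨z, hz⟩).1, ?_, ?_, funext fun θ => (hf _).2⟩
  · intro z hz
    exact (p.differentiable.analyticAt z).div (q.differentiable.analyticAt z)
      (hf ⟨z, hA.sphere_subset hz⟩).1
  · intro z hz
    have := f.norm_coe_le_norm ⟨z, hz⟩
    rw [(hf ⟨z, hz⟩).2] at this
    exact this

theorem contDiff_circleTrace (hA : IsSparse C A) (f : ratAlgZero (cheeseSet A)) :
    ContDiff ℝ 1 (circleTrace hA f) := by
  obtain ⟨u, -, hu, -, h⟩ := exists_rational_extension hA f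
  rw [h]
  exact contDiff_comp_circleMap hu

/-- The bilinear form `∮ f'(z) g(z) dz` over the unit circle, on rational functions. -/
noncomputable def boundaryForm (hA : IsSparse C A) :
    ratAlgZero (cheeseSet A) →ₗ[ℂ] ratAlgZero (cheeseSet A) →ₗ[ℂ] ℂ :=
  LinearMap.mk₂ ℂ (fun f g => circleForm (circleTrace hA f) (circleTrace hA g))
    (fun f f' g => circleForm_add_left (contDiff_circleTrace hA f) (contDiff_circleTrace hA f')
      (contDiff_circleTrace hA g))
    (fun c f _ => circleForm_smul_left c (contDiff_circleTrace hA f))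
    (fun f g g' => circleForm_add_right (contDiff_circleTrace hA f) (contDiff_circleTrace hA g)
      (contDiff_circleTrace hA g'))
    (fun c _ _ => circleForm_smul_right c)

theorem boundaryForm_apply (hA : IsSparse C A) (f g : ratAlgZero (cheeseSet A)) :
    boundaryForm hA f g = circleForm (circleTrace hA f) (circleTrace hA g) := rfl

theorem not_isWeaklyAmenable (hA : IsSparse C A) (hne : (significant A).Nonempty) :
    ¬ IsWeaklyAmenable (ratAlg (cheeseSet A)) := by
  obtain ⟨k, hk⟩ := hne
  have hb : center A k ∉ cheeseSet A := fun h =>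
    (hA.mem_cheeseCarrier_iff.1 h).2 k hk (Metric.mem_ball_self hk.2)
  refine not_isWeaklyAmenable_of_form (boundaryForm hA) (2 * π * C * (2 + C)) ?_ ?_
    (f₀ := ⟨quotientMap Polynomial.X 1 (by simp), Polynomial.X, 1, fun z => ⟨by simp, rfl⟩⟩)
    (g₀ := ⟨quotientMap 1 (Polynomial.X - Polynomial.C (center A k)) (eval_sub_ne_zero hb),
      1, Polynomial.X - Polynomial.C (center A k), fun z => ⟨eval_sub_ne_zero hb z, rfl⟩⟩) ?_
  · intro f g
    obtain ⟨u, hu, -, hub, hfu⟩ := exists_rational_extension hA f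
    obtain ⟨v, hv, -, hvb, hgv⟩ := exists_rational_extension hA g
    rw [boundaryForm_apply, hfu, hgv]
    exact norm_circleForm_le_of_hasHoleDecomposition hA hu hv hub hvb
  · intro f g h
    exact circleForm_mul_left (contDiff_circleTrace hA f) (contDiff_circleTrace hA g)
      (contDiff_circleTrace hA h)
  · -- The form takes the value `∮ dz / (z - b) = 2πi` at `z` and `1 / (z - b)`.
    have hball : center A k ∈ Metric.ball (0 : ℂ) 1 := by
      rw [mem_ball_zero_iff]
      linarith [hA.lt_one k hk, radius_nonneg A k]
    have h := circleIntegral.integral_sub_inv_of_mem_ball hball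
    rw [circleIntegral] at h
    rw [boundaryForm_apply, circleForm]
    convert Complex.two_pi_I_ne_zero using 1
    rw [← h]
    refine intervalIntegral.integral_congr fun θ _ => ?_
    have htrace : circleTrace hA (quotientMap Polynomial.X 1 (by simp)) = circleMap 0 1 :=
      funext fun t => by simp [circleTrace, quotientMap]
    simp only
    rw [htrace, smul_eq_mul]
    congr 1
    simp [circleTrace, quotientMap]

end

end SwissCheese

theorem theorem7p3 (C : ℝ) (hC : 0 < C) :
    ∃ B : SwissCheese.AbstractSwissCheese,
      SwissCheese.IsClassical B ∧
      SwissCheese.radius B 0 = 1 ∧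
      Metric.sphere (0 : ℂ) 1 ⊆ (SwissCheese.cheeseSet B : Set ℂ) ∧
      SwissCheese.HasNoBoundedPointDerivations
        (SwissCheese.ratAlg (SwissCheese.cheeseSet B)) ∧
      (Summable fun n : ℕ =>
        SwissCheese.radius B (n + 1) / SwissCheese.circleDist B (n + 1) ^ 2) ∧
      ∑' n : ℕ, SwissCheese.radius B (n + 1) / SwissCheese.circleDist B (n + 1) ^ 2 ≤ C ∧
      ¬ SwissCheese.IsWeaklyAmenable (SwissCheese.ratAlg (SwissCheese.cheeseSet B)) := by
  obtain ⟨B, hB, hne, hlarge⟩ := SwissCheese.exists_cheese hC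
  exact ⟨B, hB.isClassical, hB.radius_zero, hB.sphere_subset,
    SwissCheese.hasNoBoundedPointDerivations_of_hasLargeDerivatives hlarge,
    hB.summable_div_circleDist_sq, hB.tsum_div_circleDist_sq_le,
    SwissCheese.not_isWeaklyAmenable hB hne⟩
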